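/- **Setting.** Let $n\ge 3$, let $m_1,\dots,m_n>0$, and let $U(q)=\sum_{i<j}\frac{m_im_j}{|q_i-q_j|}$ be the Newtonian potential on $(\mathbb R^4)^n=\mathbb R^{4n}$, $M=\mathrm{diag}(m_1I_4,\dots,m_nI_4)$. A *central configuration* is a $q=(q_1,\dots,q_n)\in\mathbb R^{4n}$ with $q_i\ne q_j$ for $i\neq j$, $\sum_i m_iq_i=0$, $\langle Mq,q\rangle=1$ and $\nabla U(q)+U(q)Mq=0$. It is *planar* (*collinear*) if all $q_i$ lie in a linear subspace of $\mathbb R^4$ of dimension at most $2$ (at most $1$). Let $H(q)=[D^2U(q)+U(q)M]|_{T_q\mathbb S}$, $T_q\mathbb S=\{v:\sum_i m_iv_i=0,\ \langle Mq,v\rangle=0\}$, be the Hessian at $q$ of the restriction of $U$ to the inertia ellipsoid $\mathbb S=\{x:\sum_i m_ix_i=0,\ \langle Mx,x\rangle=1\}$; $n^-(q)$ is its negative index, $n^0(q)=\dim\ker H(q)$, and $q$ is *Morse–Bott non-degenerate* if $n^0(q)=\dim T_q(\mathrm{SO}(4)\cdot q)$, where $T_q(\mathrm{SO}(4)\cdot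 q)=\{(aq_1,\dots,aq_n): a\in\mathfrak{so}(4)\}$; otherwise it is *Morse–Bott degenerate*. Put $\kappa=\sqrt{U(q)}$ and let $\mathbf i=\mathrm{diag}(i,-i)$, $\mathbf j$, $\mathbf k$ be the left multiplications by the quaternion units on $\mathbb R^4$ (so $i$ is the rotation of $\mathbb R^2$ by $\pi/2$). The relative equilibrium (RE) generated by $q$ is $\gamma(t)=(e^{\kappa t\mathbf i}q_1,\dots,e^{\kappa t\mathbf i}q_n)$. It is *planar* if all the points $\gamma_i(t)$ lie in one plane $\Pi$ through the origin. Let $K$ be the block diagonal action on $\mathbb R^{4n}$ of $\kappa\mathbf i$ if $\gamma$ is non-planar, and of the skew map equal to $\kappa\mathbf i$ on $\Pi$ and to $0$ on $\Pi^\perp$ if $\gamma$ is planar (if $\Pi=\mathbb R^2\times\{0\}$, this is $\mathrm{diag}(\kappa i,0)$). In the rotating frame the linearization at $q$ is $\dot z=-JBz$ on $\mathbb R^{8n}$, with $$B=\begin{pmatrix}-D^2U(q)&K^{T}\\K&M^{-1}\end{pmatrix},\qquad J=\begin{pmatrix}0&-I\\I&0\end{pmatrix}.$$ Let $E_1=\{(v,\dots,v,m_1w,\dots,m_nw):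 v,w\in\mathbb R^4\}$ and $E_2=V\times MV$, where $V=\mathrm{span}\{q,\mathbf iq,\mathbf jq,\mathbf kq\}$ if $\gamma$ is non-planar and $V=\mathbb Rq+T_q(\mathrm{SO}(4)\cdot q)$ if $\gamma$ is planar. Let $E_3$ be the symplectic orthogonal complement of $E_1\oplus E_2$ in $\mathbb R^{8n}$; it is $JB$-invariant. Let $B_3$ be the restriction of (the quadratic form of) $B$ to $E_3$ and $JB_3=(JB)|_{E_3}$. Let $k=6$ if $\gamma$ is planar and $q$ is not collinear, and $k=4$ otherwise. The RE $\gamma$ is *spectrally stable* if all complex eigenvalues of $JB_3$ are purely imaginary, *linearly stable* if moreover $JB_3$ is diagonalizable over $\mathbb C$, and spectrally (linearly) *unstable* if it is not spectrally (linearly) stable. **Theorem.** Let $q$ be a central configuration and $\gamma$ the corresponding RE. 1. If $q$ is non-planar and Morse–Bott non-degenerate, or $q$ is arbitrary, Morse–Bott degenerate and $n^0(q)$ is even, then $JB_3$ has a non-trivial Jordan block for the eigenvalue $0$, and $\gamma$ is linearly unstable. 2. Suppose that $n^-\big(B_3|_{\ker (JB_3)^{8n-8-2k}}\big)$ is even.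 If $n^-(q)+n^0(q)$ is even, then $\gamma$ is spectrally unstable. In particular, still under this assumption on $B_3$, if $q$ is Morse–Bott non-degenerate then: (a) if $q$ is non-planar and $n^-(q)$ is even, then $\gamma$ is spectrally unstable; (b) if $q$ is planar and $n^-(q)$ is odd, then $\gamma$ is spectrally unstable. -/

import Mathlib

noncomputable section

namespace NBody

open scoped InnerProductSpace

/-- Euclidean four-space. -/
abbrev E4 : Type := EuclideanSpace ℝ (Fin 4)

/-- Configurations `q = (q₁, …, qₙ)` of `n` points in `ℝ⁴`, i.e. `ℝ^{4n}` with its Euclidean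
structure. -/
abbrev Config (n : ℕ) : Type := PiLp 2 (fun _ : Fin n => E4)

/-- The phase space `T*ℝ^{4n} = ℝ^{8n}`, points written `(Q, P)`. -/
abbrev Phase (n : ℕ) : Type := Config n × Config n

variable {n : ℕ}

/-- The Newtonian potential `U(q) = ∑_{i<j} mᵢ mⱼ / |qᵢ - qⱼ|`. -/
def potential (m : Fin n → ℝ) (q : Config n) : ℝ :=
  ∑ i, ∑ j ∈ Finset.Ioi i, m i * m j / ‖q i - q j‖

/-- Multiplication of the `i`-th body by the scalar `c i`, the block diagonal matrix
`diag(c₁ I₄, …, cₙ I₄)`. -/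
def scaleBodies (c : Fin n → ℝ) : Config n →ₗ[ℝ] Config n where
  toFun q := WithLp.toLp 2 fun i => c i • q i
  map_add' x y := by ext1 i; simp
  map_smul' a x := by ext1 i; simp [smul_comm a]

/-- The mass matrix `M = diag(m₁ I₄, …, mₙ I₄)`. -/
abbrev massMatrix (m : Fin n → ℝ) : Config n →ₗ[ℝ] Config n := scaleBodies m

/-- The inverse mass matrix. -/
abbrev massMatrixInv (m : Fin n → ℝ) : Config n →ₗ[ℝ] Config n := scaleBodies fun i => (m i)⁻¹

/-- The block diagonal action `diag(A, …, A)` on `ℝ^{4n}` of a linear map `A` of `ℝ⁴`. -/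
def blockDiag (n : ℕ) (A : E4 →ₗ[ℝ] E4) : Config n →ₗ[ℝ] Config n where
  toFun q := WithLp.toLp 2 fun i => A (q i)
  map_add' x y := by ext1 i; simp
  map_smul' a x := by ext1 i; simp

/-- The linear map of `ℝ⁴` given by a `4 × 4` matrix. -/
abbrev act (A : Matrix (Fin 4) (Fin 4) ℝ) : E4 →ₗ[ℝ] E4 := Matrix.toEuclideanLin A

/-- (Normalized) central configurations: collision free, with centre of mass at the origin,
`⟨Mq, q⟩ = 1`, and `∇U(q) + (U(q) / ⟨Mq, q⟩) M q = 0`. -/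
structure IsCentralConfiguration (m : Fin n → ℝ) (q : Config n) : Prop where
  collisionFree : ∀ i j, i ≠ j → q i ≠ q j
  centered : ∑ i, m i • q i = 0
  normalized : ⟪massMatrix m q, q⟫_ℝ = 1
  balance : gradient (potential m) q
    + (potential m q / ⟪massMatrix m q, q⟫_ℝ) • massMatrix m q = 0

/-- The configuration is contained in a plane through the origin (this includes collinear
configurations). -/
def IsPlanar (q : Config n) : Prop := Module.finrank ℝ (Submodule.span ℝ (Set.range q)) ≤ 2

/-- The configuration is contained in a line through the origin. -/
def IsCollinear (q : Config n) : Prop := Module.finrank ℝ (Submodule.span ℝ (Set.range q)) ≤ 1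

/-! ### The Hessian of the restricted potential -/

/-- The Hessian operator `D²U(q)`, the derivative of the gradient of `U`. -/
def hessU (m : Fin n → ℝ) (q : Config n) : Config n →ₗ[ℝ] Config n :=
  (fderiv ℝ (gradient (potential m)) q : Config n →L[ℝ] Config n)

/-- The tangent space at `q` of the inertia ellipsoid
`{x | ∑ mᵢ xᵢ = 0, ⟨Mx, x⟩ = 1}`. -/
def tangentEllipsoid (m : Fin n → ℝ) (q : Config n) : Submodule ℝ (Config n) where
  carrier := {v | ∑ i, m i • v i = 0 ∧ ⟪massMatrix m q, v⟫_ℝ = 0}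
  add_mem' := by
    rintro v w ⟨h1, h2⟩ ⟨h3, h4⟩
    refine ⟨?_, ?_⟩
    · simp [smul_add, Finset.sum_add_distrib, h1, h3]
    · rw [inner_add_right, h2, h4, add_zero]
  zero_mem' := by simp
  smul_mem' := by
    rintro c v ⟨h1, h2⟩
    refine ⟨?_, ?_⟩
    · have : ∀ i, m i • (c • v) i = c • (m i • v i) := fun i => by
        rw [PiLp.smul_apply, smul_comm]
      simp only [this, ← Finset.smul_sum, h1, smul_zero]
    · rw [inner_smul_right, h2, mul_zero]

/-- The quadratic form `v ↦ ⟨A v, v⟩` of a linear operator. -/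
def quadForm (A : Config n →ₗ[ℝ] Config n) : QuadraticForm ℝ (Config n) :=
  LinearMap.BilinMap.toQuadraticMap ((innerₗ (Config n)).comp A)

/-- The Hessian `H(q) = [D²U(q) + U(q) M]|_{T_q S}` at a central configuration `q` of the
restriction of `U` to the inertia ellipsoid `S`. -/
def hessian (m : Fin n → ℝ) (q : Config n) : QuadraticForm ℝ (tangentEllipsoid m q) :=
  (quadForm (hessU m q + potential m q • massMatrix m)).restrict (tangentEllipsoid m q)

/-- The Morse index `n⁻(q)`. -/
def morseIndex (m : Fin n → ℝ) (q : Config n) : ℕ := sigNeg (hessian m q)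

/-- The nullity `n⁰(q)`, the dimension of the kernel of `H(q)`. -/
def nullity (m : Fin n → ℝ) (q : Config n) : ℕ :=
  Module.finrank ℝ (hessian m q).radical

/-- The tangent space at `q` of the orbit `SO(4)·q`, i.e. `{(a q₁, …, a qₙ) | a ∈ so(4)}`. -/
def orbitTangent (q : Config n) : Submodule ℝ (Config n) :=
  Submodule.span ℝ {v | ∃ a ∈ LieAlgebra.Orthogonal.so (Fin 4) ℝ, v = blockDiag n (act a) q}

/-- Morse–Bott non-degeneracy: `n⁰(q) = dim T_q(SO(4)·q)`. -/
def IsMorseBottNondegenerate (m : Fin n → ℝ) (q : Config n) : Prop :=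
  nullity m q = Module.finrank ℝ (orbitTangent q)

/-! ### The relative equilibrium generated by a central configuration -/

/-- The angular speed `√λ`, `λ = U(q) / ⟨Mq, q⟩`. -/
def angularSpeed (m : Fin n → ℝ) (q : Config n) : ℝ :=
  √(potential m q / ⟪massMatrix m q, q⟫_ℝ)

/-- Left multiplication by the quaternion unit `𝐢` on `ℝ⁴`, the matrix `diag(i, -i)`. -/
def quatI : Matrix (Fin 4) (Fin 4) ℝ := !![0, -1, 0, 0; 1, 0, 0, 0; 0, 0, 0, 1; 0, 0, -1, 0]

/-- Left multiplication by the quaternion unit `𝐣`. -/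
def quatJ : Matrix (Fin 4) (Fin 4) ℝ := !![0, 0, 1, 0; 0, 0, 0, 1; -1, 0, 0, 0; 0, -1, 0, 0]

/-- Left multiplication by the quaternion unit `𝐤`. -/
def quatK : Matrix (Fin 4) (Fin 4) ℝ := !![0, 0, 0, -1; 0, 0, 1, 0; 0, -1, 0, 0; 1, 0, 0, 0]

/-- The double rotation `diag(Θ, Θ⁻¹)` of `ℝ⁴`, where `Θ` is the plane rotation of angle `φ`. -/
def doubleRotation (φ : ℝ) : Matrix (Fin 4) (Fin 4) ℝ :=
  !![Real.cos φ, -Real.sin φ, 0, 0;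
     Real.sin φ,  Real.cos φ, 0, 0;
     0, 0,  Real.cos φ, Real.sin φ;
     0, 0, -Real.sin φ, Real.cos φ]

/-- The circular relative equilibrium `t ↦ R_d(t) q` generated by `q`. -/
def relEquilibrium (m : Fin n → ℝ) (q : Config n) (t : ℝ) : Config n :=
  blockDiag n (act (doubleRotation (angularSpeed m q * t))) q

/-- The linear span in `ℝ⁴` of all the positions taken by the bodies along the relative
equilibrium. -/
def motionSpan (m : Fin n → ℝ) (q : Config n) : Submodule ℝ E4 :=
  Submodule.span ℝ {x | ∃ t i, x = relEquilibrium m q t i}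

/-- The relative equilibrium is planar: the motion takes place in a plane. -/
def IsPlanarRE (m : Fin n → ℝ) (q : Config n) : Prop :=
  Module.finrank ℝ (motionSpan m q) ≤ 2

/-- The infinitesimal generator of the rotating frame in `ℝ⁴`. For a non-planar relative
equilibrium it is `k_d = k 𝐢`. For a planar one it is the simple rotation which agrees with `k 𝐢`
on the plane of motion and vanishes on the orthogonal complement of that plane; if the plane of
motion is `ℝ² × {0}`, this is the matrix `k_s = diag(k i, 0)`. -/
def frameGenerator (m : Fin n → ℝ) (q : Config n) : E4 →ₗ[ℝ] E4 :=
  open Classical in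
  if IsPlanarRE m q then
    angularSpeed m q • (act quatI ∘ₗ ((motionSpan m q).starProjection : E4 →ₗ[ℝ] E4))
  else angularSpeed m q • act quatI

/-- The `4n × 4n` block diagonal matrix `K_d` (non-planar case) or `K_s` (planar case). -/
def frameK (m : Fin n → ℝ) (q : Config n) : Config n →ₗ[ℝ] Config n :=
  blockDiag n (frameGenerator m q)

/-- The transpose of `frameK`. -/
def frameKT (m : Fin n → ℝ) (q : Config n) : Config n →ₗ[ℝ] Config n :=
  blockDiag n (LinearMap.adjoint (frameGenerator m q))

/-! ### The linearized Hamiltonian system and its invariant subspaces -/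

/-- The standard complex structure `J (Q, P) = (-P, Q)` of `ℝ^{8n}`. -/
def stdJ (n : ℕ) : Phase n →ₗ[ℝ] Phase n :=
  (-LinearMap.snd ℝ (Config n) (Config n)).prod (LinearMap.fst ℝ (Config n) (Config n))

/-- The Euclidean scalar product of `ℝ^{8n}`. -/
def phaseInner (n : ℕ) : LinearMap.BilinForm ℝ (Phase n) :=
  (innerₗ (Config n)).compl₁₂ (LinearMap.fst ℝ _ _) (LinearMap.fst ℝ _ _)
    + (innerₗ (Config n)).compl₁₂ (LinearMap.snd ℝ _ _) (LinearMap.snd ℝ _ _)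

/-- The standard symplectic form `ω₀(z, z') = ⟨J z, z'⟩`. -/
def sympForm (n : ℕ) : LinearMap.BilinForm ℝ (Phase n) := (phaseInner n).comp (stdJ n) LinearMap.id

/-- The symmetric matrix `B = (-D²U(q), Kᵀ; K, M⁻¹)` of the linearization at `q`, in the rotating
frame; the linearized equations are `ż = -J B z`. -/
def matB (m : Fin n → ℝ) (q : Config n) : Phase n →ₗ[ℝ] Phase n :=
  (-(hessU m q) ∘ₗ LinearMap.fst ℝ _ _ + frameKT m q ∘ₗ LinearMap.snd ℝ _ _).prod
    (frameK m q ∘ₗ LinearMap.fst ℝ _ _ + massMatrixInv m ∘ₗ LinearMap.snd ℝ _ _)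

/-- The configurations `(v, …, v)`. -/
def translations (n : ℕ) : Submodule ℝ (Config n) :=
  Submodule.span ℝ {x | ∃ v : E4, x = WithLp.toLp 2 fun _ => v}

/-- The span of `q` and the directions of the rotational symmetry that are split off:
`q, 𝐢q, 𝐣q, 𝐤q` if the relative equilibrium is non-planar, and `q, K_{lr} q` (`l < r`) if it is
planar, where the matrices `k_{lr}` form the standard basis of `so(4)`. -/
def rotationDirections (m : Fin n → ℝ) (q : Config n) : Submodule ℝ (Config n) :=
  open Classical in
  if IsPlanarRE m q then Submodule.span ℝ {q} ⊔ orbitTangent q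
  else Submodule.span ℝ {q, blockDiag n (act quatI) q, blockDiag n (act quatJ) q,
    blockDiag n (act quatK) q}

/-- `E₁ = {(v, …, v, m₁ w, …, mₙ w)}`. -/
def E₁ (m : Fin n → ℝ) : Submodule ℝ (Phase n) :=
  (translations n).prod ((translations n).map (massMatrix m))

/-- `E₂`, spanned by the `(x, 0)` and `(0, M x)` with `x` in `rotationDirections`. -/
def E₂ (m : Fin n → ℝ) (q : Config n) : Submodule ℝ (Phase n) :=
  (rotationDirections m q).prod ((rotationDirections m q).map (massMatrix m))

/-- `E₃`, the symplectic orthogonal complement of `E₁ ⊕ E₂`. -/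
def E₃ (m : Fin n → ℝ) (q : Config n) : Submodule ℝ (Phase n) :=
  (sympForm n).orthogonal (E₁ m ⊔ E₂ m q)

/-! ### Invariance of `E₃` under the linearized dynamics -/

/-- The difference `xᵢ - xⱼ` as a continuous linear map. -/
def diffCLM (i j : Fin n) : Config n →L[ℝ] E4 :=
  PiLp.proj (𝕜 := ℝ) 2 (fun _ : Fin n => E4) i - PiLp.proj (𝕜 := ℝ) 2 (fun _ : Fin n => E4) j

lemma diffCLM_apply (i j : Fin n) (x : Config n) : diffCLM i j x = x i - x j := rfl

lemma sub_ne_zero_of_mem_Ioi {x : Config n} (hx : ∀ i j, i ≠ j → x i ≠ x j) {i j : Fin n}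
    (hj : j ∈ Finset.Ioi i) : x i - x j ≠ 0 :=
  sub_ne_zero.mpr (hx i j (ne_of_lt (Finset.mem_Ioi.mp hj)))

lemma contDiffAt_potential (m : Fin n → ℝ) {x : Config n} (hx : ∀ i j, i ≠ j → x i ≠ x j) :
    ContDiffAt ℝ 2 (potential m) x := by
  unfold potential
  refine ContDiffAt.sum fun i _ => ContDiffAt.sum fun j hj => ?_
  have h0 := sub_ne_zero_of_mem_Ioi hx hj
  have h1 : ContDiffAt ℝ 2 (fun y : Config n => y i - y j) x := (diffCLM i j).contDiff.contDiffAt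
  exact contDiffAt_const.div (h1.norm ℝ h0) (norm_ne_zero_iff.mpr h0)

lemma hasDerivAt_div_norm (c : ℝ) {a : E4} (ha : a ≠ 0) (b : E4) :
    HasDerivAt (fun t : ℝ => c / ‖a + t • b‖) (-(c * ⟪a, b⟫_ℝ / ‖a‖ ^ 3)) 0 := by
  have hn : ‖a‖ ≠ 0 := norm_ne_zero_iff.mpr ha
  have h2 : HasDerivAt (fun t : ℝ => a + t • b) b 0 := by
    simpa using ((hasDerivAt_id (0 : ℝ)).smul_const b).const_add a
  have h3 : HasDerivAt (fun t : ℝ => ‖a + t • b‖) (⟪a, b⟫_ℝ / ‖a‖) 0 := by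
    have h4 := (h2.norm_sq).sqrt (by simpa using ha)
    simp only [Real.sqrt_sq (norm_nonneg _)] at h4
    convert h4 using 1
    simp
    field_simp
  have h5 := (h3.inv (by simpa using ha)).const_mul c
  have h6 : -(c * ⟪a, b⟫_ℝ / ‖a‖ ^ 3) = c * (-(⟪a, b⟫_ℝ / ‖a‖) / ‖a + (0 : ℝ) • b‖ ^ 2) := by
    rw [zero_smul, add_zero]
    field_simp
  rw [h6]
  simp only [div_eq_mul_inv c]
  exact h5

lemma fderiv_potential (m : Fin n → ℝ) {x : Config n} (hx : ∀ i j, i ≠ j → x i ≠ x j)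
    (v : Config n) : fderiv ℝ (potential m) x v =
      ∑ i, ∑ j ∈ Finset.Ioi i, -(m i * m j * ⟪x i - x j, v i - v j⟫_ℝ / ‖x i - x j‖ ^ 3) := by
  have hd : DifferentiableAt ℝ (potential m) x :=
    (contDiffAt_potential m hx).differentiableAt (by norm_num)
  have h1 := hd.hasFDerivAt.hasLineDerivAt v
  have h2 : HasDerivAt (fun t : ℝ => potential m (x + t • v))
      (∑ i, ∑ j ∈ Finset.Ioi i, -(m i * m j * ⟪x i - x j, v i - v j⟫_ℝ / ‖x i - x j‖ ^ 3)) 0 := by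
    unfold potential
    refine HasDerivAt.fun_sum fun i _ => HasDerivAt.fun_sum fun j hj => ?_
    have h := hasDerivAt_div_norm (m i * m j) (sub_ne_zero_of_mem_Ioi hx hj) (v i - v j)
    have h3 : ∀ t : ℝ, (x + t • v) i - (x + t • v) j = x i - x j + t • (v i - v j) := by
      intro t
      simp only [PiLp.add_apply, PiLp.smul_apply, smul_sub]
      abel
    simpa only [h3] using h
  exact HasDerivAt.unique h1 h2

lemma isOpen_collisionFree : IsOpen {x : Config n | ∀ i j, i ≠ j → x i ≠ x j} := by
  simp only [Set.ofPred_forall]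
  refine isOpen_iInter_of_finite fun i => isOpen_iInter_of_finite fun j =>
    isOpen_iInter_of_finite fun _ => ?_
  exact isOpen_ne_fun (by fun_prop) (by fun_prop)

section Generic

variable {F : Type*} [NormedAddCommGroup F] [InnerProductSpace ℝ F] [CompleteSpace F]

lemma differentiableAt_gradient {f : F → ℝ} {x : F} (hf : ContDiffAt ℝ 2 f x) :
    DifferentiableAt ℝ (gradient f) x := by
  have h1 := (hf.fderiv_right (m := 1) (by norm_num)).differentiableAt (by norm_num)
  exact ((InnerProductSpace.toDual ℝ F).symm.toContinuousLinearEquiv.differentiableAt).comp x h1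

lemma inner_fderiv_gradient {f : F → ℝ} {x : F} (hf : ContDiffAt ℝ 2 f x) (v w : F) :
    ⟪fderiv ℝ (gradient f) x v, w⟫_ℝ = fderiv ℝ (fderiv ℝ f) x v w := by
  have h := (hf.fderiv_right (m := 1) (by norm_num)).differentiableAt (by norm_num)
  have h1 := (differentiableAt_gradient hf).hasFDerivAt.inner ℝ (hasFDerivAt_const w x)
  have h2 := h.hasFDerivAt.clm_apply (hasFDerivAt_const w x)
  simp only [inner_gradient_left] at h1
  have := congrArg (fun A => A v) (h1.unique h2)
  simpa using this

lemma fderiv_gradient_symm {f : F → ℝ} {x : F} (hf : ContDiffAt ℝ 2 f x) (v w : F) :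
    ⟪fderiv ℝ (gradient f) x v, w⟫_ℝ = ⟪v, fderiv ℝ (gradient f) x w⟫_ℝ := by
  rw [inner_fderiv_gradient hf, real_inner_comm, inner_fderiv_gradient hf]
  exact (hf.isSymmSndFDerivAt (by simp)) v w

/-- Differentiating an infinitesimal symmetry `df(x)(A x + e) = c f(x)`. -/
lemma fderiv_gradient_of_symmetry {f : F → ℝ} {x : F} (hf : ContDiffAt ℝ 2 f x)
    (A : F →L[ℝ] F) (e : F) (c : ℝ)
    (h : ∀ᶠ y in nhds x, fderiv ℝ f y (A y + e) = c * f y) (v : F) :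
    ⟪fderiv ℝ (gradient f) x (A x + e), v⟫_ℝ =
      c * ⟪gradient f x, v⟫_ℝ - ⟪gradient f x, A v⟫_ℝ := by
  have hA : HasFDerivAt (fun y : F => A y + e) A x := A.hasFDerivAt.add_const e
  have h1 := (differentiableAt_gradient hf).hasFDerivAt.inner ℝ hA
  have h2 := ((hf.differentiableAt (by norm_num)).hasFDerivAt).const_mul c
  have h3 : (fun y : F => ⟪gradient f y, A y + e⟫_ℝ) =ᶠ[nhds x] fun y => c * f y := by
    filter_upwards [h] with y hy
    rw [inner_gradient_left, hy]
  have h4 := congrArg (fun L => L v) ((h1.congr_of_eventuallyEq h3.symm).unique h2)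
  rw [fderiv_gradient_symm hf, real_inner_comm]
  have h5 : ⟪gradient f x, A v⟫_ℝ + ⟪fderiv ℝ (gradient f) x v, A x + e⟫_ℝ
      = c * fderiv ℝ f x v := h4
  rw [← inner_gradient_left] at h5
  linarith

lemma fderiv_gradient_of_symmetry' [FiniteDimensional ℝ F] {f : F → ℝ} {x : F}
    (hf : ContDiffAt ℝ 2 f x) (A : F →ₗ[ℝ] F) (e : F) (c : ℝ)
    (h : ∀ᶠ y in nhds x, fderiv ℝ f y (A y + e) = c * f y) (v : F) :
    ⟪fderiv ℝ (gradient f) x (A x + e), v⟫_ℝ =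
      c * ⟪gradient f x, v⟫_ℝ - ⟪gradient f x, A v⟫_ℝ :=
  fderiv_gradient_of_symmetry hf (LinearMap.toContinuousLinearMap A) e c h v

end Generic

lemma hessU_symm (m : Fin n → ℝ) {x : Config n} (hx : ∀ i j, i ≠ j → x i ≠ x j)
    (v w : Config n) : ⟪hessU m x v, w⟫_ℝ = ⟪v, hessU m x w⟫_ℝ :=
  fderiv_gradient_symm (contDiffAt_potential m hx) v w

lemma hessU_of_symmetry (m : Fin n → ℝ) {q : Config n} (hq : ∀ i j, i ≠ j → q i ≠ q j)
    (A : Config n →ₗ[ℝ] Config n) (e : Config n) (c : ℝ)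
    (h : ∀ x : Config n, (∀ i j, i ≠ j → x i ≠ x j) →
      fderiv ℝ (potential m) x (A x + e) = c * potential m x) (v : Config n) :
    ⟪hessU m q (A q + e), v⟫_ℝ =
      c * ⟪gradient (potential m) q, v⟫_ℝ - ⟪gradient (potential m) q, A v⟫_ℝ := by
  have h1 : ∀ᶠ y in nhds q, (∀ i j, i ≠ j → y i ≠ y j) :=
    isOpen_collisionFree.mem_nhds hq
  exact fderiv_gradient_of_symmetry' (contDiffAt_potential m hq) A e c
    (h1.mono fun y hy => h y hy) v

lemma inner_config (x y : Config n) : ⟪x, y⟫_ℝ = ∑ i, ⟪x i, y i⟫_ℝ := PiLp.inner_apply x y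

lemma inner_massMatrix (m : Fin n → ℝ) (x y : Config n) :
    ⟪massMatrix m x, y⟫_ℝ = ⟪x, massMatrix m y⟫_ℝ := by
  simp [inner_config, scaleBodies, inner_smul_left, inner_smul_right]

lemma massMatrix_blockDiag (m : Fin n → ℝ) (A : E4 →ₗ[ℝ] E4) (x : Config n) :
    massMatrix m (blockDiag n A x) = blockDiag n A (massMatrix m x) := by
  ext1 i; simp [scaleBodies, blockDiag]

lemma IsCentralConfiguration.gradient_eq {m : Fin n → ℝ} {q : Config n}
    (hq : IsCentralConfiguration m q) :
    gradient (potential m) q = -potential m q • massMatrix m q := by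
  have := hq.balance
  rw [hq.normalized, div_one] at this
  rw [eq_neg_of_add_eq_zero_left this, neg_smul]

lemma hessU_translation {m : Fin n → ℝ} {q : Config n} (hq : IsCentralConfiguration m q)
    (v : E4) : hessU m q (WithLp.toLp 2 fun _ => v) = 0 := by
  refine ext_inner_right ℝ fun w => ?_
  have := hessU_of_symmetry m hq.collisionFree 0 (WithLp.toLp 2 fun _ => v) 0
    (fun x hx => by rw [fderiv_potential m hx]; simp) w
  simpa using this

lemma hessU_self {m : Fin n → ℝ} {q : Config n} (hq : IsCentralConfiguration m q) :
    hessU m q q = (2 * potential m q) • massMatrix m q := by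
  refine ext_inner_right ℝ fun w => ?_
  have := hessU_of_symmetry m hq.collisionFree LinearMap.id 0 (-1) (fun x hx => by
    rw [fderiv_potential m hx, potential, Finset.mul_sum]
    refine Finset.sum_congr rfl fun i _ => ?_
    rw [Finset.mul_sum]
    refine Finset.sum_congr rfl fun j hj => ?_
    have hn : ‖x i - x j‖ ≠ 0 := norm_ne_zero_iff.mpr (sub_ne_zero_of_mem_Ioi hx hj)
    simp
    field_simp) w
  simp only [LinearMap.id_apply, add_zero] at this
  rw [this, hq.gradient_eq]
  simp only [inner_smul_left]
  simp
  ring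

/-- A linear map of `ℝ⁴` is skew if `⟨a x, y⟩ = -⟨x, a y⟩`. -/
def IsSkew (a : E4 →ₗ[ℝ] E4) : Prop := ∀ x y, ⟪a x, y⟫_ℝ = -⟪x, a y⟫_ℝ

lemma IsSkew.inner_self {a : E4 →ₗ[ℝ] E4} (ha : IsSkew a) (x : E4) : ⟪x, a x⟫_ℝ = 0 := by
  have := ha x x
  rw [real_inner_comm] at this
  linarith

lemma hessU_skew {m : Fin n → ℝ} {q : Config n} (hq : IsCentralConfiguration m q)
    {a : E4 →ₗ[ℝ] E4} (ha : IsSkew a) :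
    hessU m q (blockDiag n a q) = (-potential m q) • massMatrix m (blockDiag n a q) := by
  refine ext_inner_right ℝ fun w => ?_
  have := hessU_of_symmetry m hq.collisionFree (blockDiag n a) 0 0 (fun x hx => by
    rw [fderiv_potential m hx]
    simp [blockDiag, ← map_sub, ha.inner_self]) w
  simp only [add_zero] at this
  rw [this, hq.gradient_eq, massMatrix_blockDiag]
  simp only [inner_smul_left, inner_config]
  simp [blockDiag, ha _ _]

lemma isSkew_act {a : Matrix (Fin 4) (Fin 4) ℝ} (ha : a.transpose = -a) : IsSkew (act a) := by
  intro x y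
  have h : ∀ i j, a j i = -a i j := fun i j => congrFun (congrFun ha i) j
  simp only [PiLp.inner_apply, act, Matrix.toLpLin_apply, Matrix.mulVec, dotProduct,
    RCLike.inner_apply, conj_trivial, Finset.mul_sum, Finset.sum_mul]
  rw [Finset.sum_comm, ← Finset.sum_neg_distrib]
  refine Finset.sum_congr rfl fun i _ => ?_
  rw [← Finset.sum_neg_distrib]
  refine Finset.sum_congr rfl fun j _ => ?_
  rw [h i j]; ring

lemma quatI_skew : IsSkew (act quatI) :=
  isSkew_act (by ext i j; fin_cases i <;> fin_cases j <;> simp [quatI])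
lemma quatJ_skew : IsSkew (act quatJ) :=
  isSkew_act (by ext i j; fin_cases i <;> fin_cases j <;> simp [quatJ])
lemma quatK_skew : IsSkew (act quatK) :=
  isSkew_act (by ext i j; fin_cases i <;> fin_cases j <;> simp [quatK])

lemma act_mul (A B : Matrix (Fin 4) (Fin 4) ℝ) (x : E4) : act (A * B) x = act A (act B x) := by
  simp [act, Matrix.toLpLin_apply]

lemma act_quatI_quatI (x : E4) : act quatI (act quatI x) = -x := by
  rw [← act_mul]
  have : quatI * quatI = -1 := by
    ext i j; fin_cases i <;> fin_cases j <;> simp [quatI, Matrix.mul_apply, Fin.sum_univ_four]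
  rw [this]; simp [act]

lemma quatI_mul_quatJ : quatI * quatJ = quatK := by
  ext i j; fin_cases i <;> fin_cases j <;>
    simp [quatI, quatJ, quatK, Matrix.mul_apply, Fin.sum_univ_four]

lemma quatI_mul_quatK : quatI * quatK = -quatJ := by
  ext i j; fin_cases i <;> fin_cases j <;>
    simp [quatI, quatJ, quatK, Matrix.mul_apply, Fin.sum_univ_four]

lemma quatI_mul_doubleRotation (φ : ℝ) :
    quatI * doubleRotation φ = doubleRotation (φ + Real.pi / 2) := by
  ext i j; fin_cases i <;> fin_cases j <;>
    simp [quatI, doubleRotation, Matrix.mul_apply, Fin.sum_univ_four, Real.cos_add_pi_div_two,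
      Real.sin_add_pi_div_two]

lemma mem_motionSpan (m : Fin n → ℝ) (q : Config n) (i : Fin n) : q i ∈ motionSpan m q := by
  refine Submodule.subset_span ⟨0, i, ?_⟩
  have : doubleRotation (angularSpeed m q * 0) = 1 := by
    ext i j; fin_cases i <;> fin_cases j <;> simp [doubleRotation]
  simp only [relEquilibrium, this, blockDiag]
  simp [act]

lemma quatI_mem_motionSpan (m : Fin n → ℝ) (q : Config n) (hk : angularSpeed m q ≠ 0) {x : E4}
    (hx : x ∈ motionSpan m q) : act quatI x ∈ motionSpan m q := by
  unfold motionSpan at hx ⊢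
  induction hx using Submodule.span_induction with
  | mem x h =>
    obtain ⟨t, i, rfl⟩ := h
    refine Submodule.subset_span ⟨t + Real.pi / 2 / angularSpeed m q, i, ?_⟩
    have h1 : angularSpeed m q * (t + Real.pi / 2 / angularSpeed m q)
        = angularSpeed m q * t + Real.pi / 2 := by field_simp
    simp only [relEquilibrium, h1, ← quatI_mul_doubleRotation, blockDiag]
    exact (act_mul _ _ _).symm
  | zero => simp
  | add x y _ _ h1 h2 => rw [map_add]; exact add_mem h1 h2
  | smul c x _ h => rw [map_smul]; exact Submodule.smul_mem _ c h

lemma starProjection_comm {a : E4 →ₗ[ℝ] E4} (ha : IsSkew a) {W : Submodule ℝ E4}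
    (hW : ∀ x ∈ W, a x ∈ W) (x : E4) : W.starProjection (a x) = a (W.starProjection x) := by
  refine Submodule.eq_starProjection_of_mem_of_inner_eq_zero
    (hW _ (W.starProjection_apply_mem x)) fun w hw => ?_
  rw [← map_sub, ha, W.starProjection_inner_eq_zero x _ (hW w hw), neg_zero]

lemma frameGenerator_skew (m : Fin n → ℝ) (q : Config n) : IsSkew (frameGenerator m q) := by
  unfold frameGenerator
  split_ifs with h
  · by_cases hk : angularSpeed m q = 0
    · intro x y; simp [hk]
    · intro x y
      have h1 := starProjection_comm quatI_skew (fun x hx => quatI_mem_motionSpan m q hk hx) y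
      simp only [LinearMap.smul_apply, LinearMap.comp_apply, ContinuousLinearMap.coe_coe,
        inner_smul_left, inner_smul_right, conj_trivial]
      rw [quatI_skew, Submodule.inner_starProjection_left_eq_right, h1, mul_neg]
  · intro x y
    simp only [LinearMap.smul_apply, inner_smul_left, inner_smul_right, conj_trivial]
    rw [quatI_skew, mul_neg]

lemma frameKT_eq (m : Fin n → ℝ) (q : Config n) : frameKT m q = -frameK m q := by
  have h : LinearMap.adjoint (frameGenerator m q) = -frameGenerator m q := by
    symm
    rw [LinearMap.eq_adjoint_iff]
    intro x y
    rw [LinearMap.neg_apply, inner_neg_left, frameGenerator_skew, neg_neg]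
  unfold frameKT frameK
  rw [h]
  ext x i : 2
  simp [blockDiag]

lemma inner_frameK (m : Fin n → ℝ) (q x y : Config n) :
    ⟪frameK m q x, y⟫_ℝ = -⟪x, frameK m q y⟫_ℝ := by
  simp [inner_config, frameK, blockDiag, frameGenerator_skew m q _ _]

lemma translations_eq {x : Config n} (hx : x ∈ translations n) :
    ∃ v : E4, x = WithLp.toLp 2 fun _ => v := by
  unfold translations at hx
  induction hx using Submodule.span_induction with
  | mem x h => exact h
  | zero => exact ⟨0, by ext1 i; simp⟩
  | add x y _ _ h1 h2 =>
    obtain ⟨v, rfl⟩ := h1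
    obtain ⟨w, rfl⟩ := h2
    exact ⟨v + w, by ext1 i; simp⟩
  | smul c x _ h =>
    obtain ⟨v, rfl⟩ := h
    exact ⟨c • v, by ext1 i; simp⟩

lemma frameK_translations (m : Fin n → ℝ) (q : Config n) {x : Config n}
    (hx : x ∈ translations n) : frameK m q x ∈ translations n := by
  obtain ⟨v, rfl⟩ := translations_eq hx
  exact Submodule.subset_span ⟨frameGenerator m q v, rfl⟩

lemma orbitTangent_eq {q x : Config n} (hx : x ∈ orbitTangent q) :
    ∃ a : E4 →ₗ[ℝ] E4, IsSkew a ∧ x = blockDiag n a q := by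
  unfold orbitTangent at hx
  induction hx using Submodule.span_induction with
  | mem x h =>
    obtain ⟨a, ha, rfl⟩ := h
    exact ⟨act a, isSkew_act ((LieAlgebra.Orthogonal.mem_so _ _ a).mp ha), rfl⟩
  | zero => exact ⟨0, fun x y => by simp, by ext1 i; simp [blockDiag]⟩
  | add x y _ _ h1 h2 =>
    obtain ⟨a, ha, rfl⟩ := h1
    obtain ⟨b, hb, rfl⟩ := h2
    refine ⟨a + b, fun x y => ?_, by ext1 i; simp [blockDiag]⟩
    simp only [LinearMap.add_apply, inner_add_left, inner_add_right, ha x y, hb x y]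
    ring
  | smul c x _ h =>
    obtain ⟨a, ha, rfl⟩ := h
    refine ⟨c • a, fun x y => ?_, by ext1 i; simp [blockDiag]⟩
    simp only [LinearMap.smul_apply, inner_smul_left, inner_smul_right, ha x y, conj_trivial]
    ring

lemma quatI_mem_so : quatI ∈ LieAlgebra.Orthogonal.so (Fin 4) ℝ := by
  rw [LieAlgebra.Orthogonal.mem_so]
  ext i j; fin_cases i <;> fin_cases j <;> simp [quatI]

/-- On an `𝐢`-invariant plane, the compression of a skew map is a multiple of `𝐢`. -/
lemma starProjection_skew {a : E4 →ₗ[ℝ] E4} (ha : IsSkew a) {W : Submodule ℝ E4}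
    (hW : ∀ x ∈ W, act quatI x ∈ W) (hd : Module.finrank ℝ W ≤ 2) :
    ∃ c : ℝ, ∀ x ∈ W, W.starProjection (a x) = c • act quatI x := by
  by_cases h0 : W = ⊥
  · refine ⟨0, fun x hx => ?_⟩
    rw [h0, Submodule.mem_bot] at hx
    simp [hx]
  obtain ⟨u, hu, hu0⟩ := Submodule.exists_mem_ne_zero_of_ne_bot h0
  set I : E4 →ₗ[ℝ] E4 := act quatI with hI
  have hIu : ⟪I u, u⟫_ℝ = 0 := by rw [real_inner_comm]; exact quatI_skew.inner_self u
  have huu : ⟪u, u⟫_ℝ ≠ 0 := inner_self_ne_zero.mpr hu0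
  have hII : ⟪I u, I u⟫_ℝ = ⟪u, u⟫_ℝ := by
    rw [hI, quatI_skew, act_quatI_quatI, inner_neg_right, neg_neg]
  have hli : LinearIndependent ℝ ![u, I u] := by
    rw [LinearIndependent.pair_iff]
    intro s t hst
    have h1 : ⟪s • u + t • I u, u⟫_ℝ = 0 := by rw [hst, inner_zero_left]
    have h2 : ⟪s • u + t • I u, I u⟫_ℝ = 0 := by rw [hst, inner_zero_left]
    rw [inner_add_left, inner_smul_left, inner_smul_left, hIu] at h1
    rw [inner_add_left, inner_smul_left, inner_smul_left, real_inner_comm, hIu, hII] at h2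
    simp only [conj_trivial, mul_zero, add_zero, zero_add, mul_eq_zero, huu, or_false] at h1 h2
    exact ⟨h1, h2⟩
  have hspan : Submodule.span ℝ {u, I u} = W := by
    refine Submodule.eq_of_le_of_finrank_le ?_ ?_
    · rw [Submodule.span_le]
      rintro x (rfl | rfl)
      · exact hu
      · exact hW _ hu
    · have := finrank_span_eq_card hli
      have h2 : Set.range ![u, I u] = {u, I u} := by simp [Matrix.range_cons, Set.pair_comm]
      rw [h2] at this
      rw [this]; exact hd
  have hrep : ∀ x ∈ W, ∃ α β : ℝ, x = α • u + β • I u := by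
    intro x hx
    rw [← hspan, Submodule.mem_span_pair] at hx
    obtain ⟨α, β, h⟩ := hx
    exact ⟨α, β, h.symm⟩
  refine ⟨⟪a u, I u⟫_ℝ / ⟪u, u⟫_ℝ, fun x hx => ?_⟩
  refine Submodule.eq_starProjection_of_mem_of_inner_eq_zero
    (W.smul_mem _ (hW x hx)) fun w hw => ?_
  obtain ⟨α, β, rfl⟩ := hrep x hx
  obtain ⟨γ, δ, rfl⟩ := hrep w hw
  have e1 : ⟪a u, u⟫_ℝ = 0 := by rw [real_inner_comm]; exact ha.inner_self u
  have e2 : ⟪a (I u), I u⟫_ℝ = 0 := by rw [real_inner_comm]; exact ha.inner_self (I u)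
  have e3 : ⟪a (I u), u⟫_ℝ = -⟪a u, I u⟫_ℝ := by rw [ha, real_inner_comm]
  have e4 : I (I u) = -u := act_quatI_quatI u
  have e5 : ⟪u, I u⟫_ℝ = 0 := by rw [real_inner_comm]; exact hIu
  simp only [map_add, map_smul, e4, inner_sub_left, inner_add_left, inner_add_right,
    inner_smul_left, inner_smul_right, inner_neg_left, conj_trivial, e1, e2, e3, hIu, hII, e5]
  field_simp
  ring

lemma frameK_rotationDirections (m : Fin n → ℝ) (q : Config n) {x : Config n}
    (hx : x ∈ rotationDirections m q) : frameK m q x ∈ rotationDirections m q := by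
  by_cases hk : angularSpeed m q = 0
  · have : frameK m q x = 0 := by
      unfold frameK frameGenerator
      ext1 i
      simp [blockDiag, hk]
    rw [this]; exact zero_mem _
  by_cases hp : IsPlanarRE m q
  · have hR : rotationDirections m q = Submodule.span ℝ {q} ⊔ orbitTangent q := by
      unfold rotationDirections; rw [if_pos hp]
    have hG : frameGenerator m q = angularSpeed m q •
        (act quatI ∘ₗ ((motionSpan m q).starProjection : E4 →ₗ[ℝ] E4)) := by
      unfold frameGenerator; rw [if_pos hp]
    rw [hR] at hx ⊢
    have hI : ∀ x ∈ motionSpan m q, act quatI x ∈ motionSpan m q :=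
      fun x hx => quatI_mem_motionSpan m q hk hx
    obtain ⟨y, hy, z, hz, rfl⟩ := Submodule.mem_sup.mp hx
    rw [map_add]
    refine add_mem ?_ ?_
    · obtain ⟨c, rfl⟩ := Submodule.mem_span_singleton.mp hy
      rw [map_smul]
      refine Submodule.smul_mem _ _ (Submodule.mem_sup_right ?_)
      have : frameK m q q = angularSpeed m q • blockDiag n (act quatI) q := by
        ext1 i
        simp only [frameK, hG, blockDiag]
        simp [(Submodule.starProjection_eq_self_iff).mpr (mem_motionSpan m q i)]
      rw [this]
      exact Submodule.smul_mem _ _ (Submodule.subset_span ⟨quatI, quatI_mem_so, rfl⟩)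
    · obtain ⟨a, ha, rfl⟩ := orbitTangent_eq hz
      obtain ⟨c, hc⟩ := starProjection_skew ha hI hp
      refine Submodule.mem_sup_left (Submodule.mem_span_singleton.mpr ⟨-(angularSpeed m q * c), ?_⟩)
      ext1 i
      simp only [frameK, hG, blockDiag]
      simp [hc _ (mem_motionSpan m q i), act_quatI_quatI, mul_smul]
  · have hR : rotationDirections m q = Submodule.span ℝ {q, blockDiag n (act quatI) q,
        blockDiag n (act quatJ) q, blockDiag n (act quatK) q} := by
      unfold rotationDirections; rw [if_neg hp]
    have hG : frameGenerator m q = angularSpeed m q • act quatI := by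
      unfold frameGenerator; rw [if_neg hp]
    have hF : ∀ y, frameK m q y = angularSpeed m q • blockDiag n (act quatI) y := by
      intro y; ext1 i; simp [frameK, hG, blockDiag]
    rw [hR] at hx ⊢
    induction hx using Submodule.span_induction with
    | zero => simp
    | add x y _ _ h1 h2 => rw [map_add]; exact add_mem h1 h2
    | smul c x _ h => rw [map_smul]; exact Submodule.smul_mem _ c h
    | mem x h =>
      rw [hF]
      refine Submodule.smul_mem _ _ ?_
      rcases h with rfl | rfl | rfl | rfl
      · exact Submodule.subset_span (by simp)
      · have : blockDiag n (act quatI) (blockDiag n (act quatI) q) = -q := by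
          ext1 i; simp [blockDiag, act_quatI_quatI]
        rw [this]
        exact neg_mem (Submodule.subset_span (by simp))
      · have : blockDiag n (act quatI) (blockDiag n (act quatJ) q)
            = blockDiag n (act quatK) q := by
          ext1 i; simp only [blockDiag, ← quatI_mul_quatJ]; exact (act_mul _ _ _).symm
        rw [this]
        exact Submodule.subset_span (by simp)
      · have : blockDiag n (act quatI) (blockDiag n (act quatK) q)
            = -blockDiag n (act quatJ) q := by
          ext1 i
          have := act_mul quatI quatK (q i)
          rw [quatI_mul_quatK] at this
          simp only [blockDiag]
          exact this.symm.trans (by simp [act])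
        rw [this]
        exact neg_mem (Submodule.subset_span (by simp))

lemma hessU_rotationDirections {m : Fin n → ℝ} {q : Config n} (hq : IsCentralConfiguration m q)
    {x : Config n} (hx : x ∈ rotationDirections m q) :
    hessU m q x ∈ (rotationDirections m q).map (massMatrix m) := by
  have key : ∀ (R : Submodule ℝ (Config n)), (∃ c : ℝ, ∃ y ∈ R, hessU m q x = c • massMatrix m y) →
      hessU m q x ∈ R.map (massMatrix m) := by
    rintro R ⟨c, y, hy, h⟩
    rw [h]
    exact Submodule.smul_mem _ _ (Submodule.mem_map_of_mem hy)
  by_cases hp : IsPlanarRE m q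
  · have hR : rotationDirections m q = Submodule.span ℝ {q} ⊔ orbitTangent q := by
      unfold rotationDirections; rw [if_pos hp]
    rw [hR] at hx ⊢
    obtain ⟨y, hy, z, hz, rfl⟩ := Submodule.mem_sup.mp hx
    rw [map_add]
    refine add_mem ?_ ?_
    · obtain ⟨c, rfl⟩ := Submodule.mem_span_singleton.mp hy
      rw [map_smul, hessU_self hq]
      exact Submodule.smul_mem _ _ (Submodule.smul_mem _ _ (Submodule.mem_map_of_mem
        (Submodule.mem_sup_left (Submodule.mem_span_singleton_self q))))
    · obtain ⟨a, ha, h⟩ := orbitTangent_eq hz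
      have h2 : hessU m q z = (-potential m q) • massMatrix m z := by rw [h, hessU_skew hq ha]
      rw [h2]
      exact Submodule.smul_mem _ _ (Submodule.mem_map_of_mem (Submodule.mem_sup_right hz))
  · have hR : rotationDirections m q = Submodule.span ℝ {q, blockDiag n (act quatI) q,
        blockDiag n (act quatJ) q, blockDiag n (act quatK) q} := by
      unfold rotationDirections; rw [if_neg hp]
    rw [hR] at hx ⊢
    clear key
    induction hx using Submodule.span_induction with
    | zero => simp
    | add x y _ _ h1 h2 => rw [map_add]; exact add_mem h1 h2
    | smul c x _ h => rw [map_smul]; exact Submodule.smul_mem _ c h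
    | mem x h =>
      have hx := Submodule.mem_map_of_mem (f := massMatrix m) (Submodule.subset_span h)
      rcases h with rfl | rfl | rfl | rfl
      · rw [hessU_self hq]; exact Submodule.smul_mem _ _ hx
      · rw [hessU_skew hq quatI_skew]; exact Submodule.smul_mem _ _ hx
      · rw [hessU_skew hq quatJ_skew]; exact Submodule.smul_mem _ _ hx
      · rw [hessU_skew hq quatK_skew]; exact Submodule.smul_mem _ _ hx

/-- The matrix `J B`. -/
def matJB (m : Fin n → ℝ) (q : Config n) : Phase n →ₗ[ℝ] Phase n := stdJ n ∘ₗ matB m q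

lemma matB_apply (m : Fin n → ℝ) (q x p : Config n) : matB m q (x, p) =
    (-hessU m q x - frameK m q p, frameK m q x + massMatrixInv m p) := by
  simp [matB, frameKT_eq, sub_eq_add_neg]

lemma matJB_apply (m : Fin n → ℝ) (q x p : Config n) : matJB m q (x, p) =
    (-(frameK m q x + massMatrixInv m p), -hessU m q x - frameK m q p) := by
  rw [matJB, LinearMap.comp_apply, matB_apply]
  simp [stdJ]

lemma matJB_mem_prod {m : Fin n → ℝ} (hm : ∀ i, 0 < m i) {q : Config n}
    {W : Submodule ℝ (Config n)}
    (hK : ∀ x ∈ W, frameK m q x ∈ W) (hU : ∀ x ∈ W, hessU m q x ∈ W.map (massMatrix m))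
    {z : Phase n} (hz : z ∈ W.prod (W.map (massMatrix m))) :
    matJB m q z ∈ W.prod (W.map (massMatrix m)) := by
  obtain ⟨x, p⟩ := z
  obtain ⟨hx, y, hy, rfl⟩ := hz
  have hinv : massMatrixInv m (massMatrix m y) = y := by
    ext1 i; simp [scaleBodies, smul_smul, (hm i).ne']
  rw [matJB_apply, hinv]
  refine ⟨neg_mem (add_mem (hK x hx) hy), sub_mem (neg_mem (hU x hx)) ?_⟩
  have : frameK m q (massMatrix m y) = massMatrix m (frameK m q y) :=
    (massMatrix_blockDiag m _ y).symm
  rw [this]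
  exact Submodule.mem_map_of_mem (hK y hy)

lemma sympForm_apply (z w : Phase n) : sympForm n z w = -⟪z.2, w.1⟫_ℝ + ⟪z.1, w.2⟫_ℝ := by
  simp [sympForm, phaseInner, stdJ]

lemma sympForm_matJB {m : Fin n → ℝ} {q : Config n} (hq : IsCentralConfiguration m q)
    (z w : Phase n) : sympForm n z (matJB m q w) = -sympForm n (matJB m q z) w := by
  obtain ⟨x, p⟩ := z
  obtain ⟨y, r⟩ := w
  rw [matJB_apply, matJB_apply, sympForm_apply, sympForm_apply]
  have h1 := hessU_symm m hq.collisionFree x y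
  have h2 := inner_frameK m q x r
  have h3 := inner_frameK m q p y
  have h4 := inner_massMatrix (fun i => (m i)⁻¹) p r
  simp only [inner_neg_right, inner_neg_left, inner_add_right, inner_add_left, inner_sub_left,
    inner_sub_right]
  linarith

/-- `E₃` is invariant under the linearized dynamics. -/
lemma matJB_mem_E₃ {m : Fin n → ℝ} (hm : ∀ i, 0 < m i) {q : Config n}
    (hq : IsCentralConfiguration m q) : ∀ z ∈ E₃ m q, matJB m q z ∈ E₃ m q := by
  intro z hz
  unfold E₃ at hz ⊢
  rw [LinearMap.BilinForm.mem_orthogonal_iff] at hz ⊢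
  intro w hw
  have h12 : matJB m q w ∈ E₁ m ⊔ E₂ m q := by
    obtain ⟨w1, h1, w2, h2, rfl⟩ := Submodule.mem_sup.mp hw
    rw [map_add]
    refine Submodule.add_mem_sup ?_ ?_
    · refine matJB_mem_prod hm (fun x hx => frameK_translations m q hx) (fun x hx => ?_) h1
      obtain ⟨v, rfl⟩ := translations_eq hx
      rw [hessU_translation hq]
      exact zero_mem _
    · exact matJB_mem_prod hm (fun x hx => frameK_rotationDirections m q hx)
        (fun x hx => hessU_rotationDirections hq hx) h2
  have h := hz _ h12
  change sympForm n (matJB m q w) z = 0 at h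
  change sympForm n w (matJB m q z) = 0
  rw [sympForm_matJB hq, h, neg_zero]

/-! ### Reduced system and stability -/

/-- `J B₃`, the restriction of `J B` to the invariant subspace `E₃`. -/
def matJB₃ {m : Fin n → ℝ} (hm : ∀ i, 0 < m i) {q : Config n}
    (hq : IsCentralConfiguration m q) : Module.End ℝ (E₃ m q) :=
  (matJB m q).restrict (matJB_mem_E₃ hm hq)

/-- The quadratic form `z ↦ ⟨B z, z⟩` of `B₃`, the restriction of `B` to `E₃`. -/
def formB₃ (m : Fin n → ℝ) (q : Config n) : QuadraticForm ℝ (E₃ m q) :=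
  (LinearMap.BilinMap.toQuadraticMap
    ((phaseInner n).comp (matB m q) LinearMap.id)).restrict (E₃ m q)

/-- The number `k`: `6` for a planar relative equilibrium generated by a non-collinear
configuration, and `4` otherwise. -/
def blockSize (m : Fin n → ℝ) (q : Config n) : ℕ :=
  open Classical in if IsPlanarRE m q ∧ ¬ IsCollinear q then 6 else 4

/-- The generalized kernel `ker (J B₃)^{8n-8-2k}`. -/
def generalizedKernel {m : Fin n → ℝ} (hm : ∀ i, 0 < m i) {q : Config n}
    (hq : IsCentralConfiguration m q) : Submodule ℝ (E₃ m q) :=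
  LinearMap.ker (matJB₃ hm hq ^ (8 * n - 8 - 2 * blockSize m q))

/-- The Morse index `n⁻` of the restriction of `B₃` to the generalized kernel of `J B₃`. -/
def indexOnGeneralizedKernel {m : Fin n → ℝ} (hm : ∀ i, 0 < m i) {q : Config n}
    (hq : IsCentralConfiguration m q) : ℕ :=
  sigNeg (R := ℝ) (M := generalizedKernel hm hq)
    ((formB₃ m q).restrict (generalizedKernel hm hq))

/-- The relative equilibrium is spectrally stable: all complex eigenvalues of `J B₃` are purely
imaginary. -/
def SpectrallyStable {m : Fin n → ℝ} (hm : ∀ i, 0 < m i) {q : Config n}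
    (hq : IsCentralConfiguration m q) : Prop :=
  ∀ μ : ℂ, Module.End.HasEigenvalue ((matJB₃ hm hq).baseChange ℂ) μ → μ.re = 0

/-- The relative equilibrium is linearly stable: it is spectrally stable and `J B₃` is
diagonalizable over `ℂ`. -/
def LinearlyStable {m : Fin n → ℝ} (hm : ∀ i, 0 < m i) {q : Config n}
    (hq : IsCentralConfiguration m q) : Prop :=
  SpectrallyStable hm hq ∧
    ⨆ μ : ℂ, Module.End.eigenspace ((matJB₃ hm hq).baseChange ℂ) μ = ⊤

/-- `J B₃` has a non-trivial Jordan block for the eigenvalue `0`. -/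
def HasNontrivialJordanBlockAtZero {m : Fin n → ℝ} (hm : ∀ i, 0 < m i) {q : Config n}
    (hq : IsCentralConfiguration m q) : Prop :=
  LinearMap.ker (matJB₃ hm hq) < LinearMap.ker (matJB₃ hm hq ^ 2)

end NBody

end

/-! Both instability statements are parity arguments for the Hamiltonian map `A = JB₃` on the
symplectic space `E₃`, where `B₃(z) = -ω(A z, z)`.

Linear algebra. If `ker A² = ker A`, then `E₃` is the symplectically orthogonal sum of `ker A` and
`range A`, both symplectic, so `dim ker A` is even (`even_finrank_ker`). If `A` has no nonzero real
eigenvalue, then on the range of a high power of `A` it has no real eigenvector. A real matrix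
without real eigenvectors has positive determinant, so the Gram determinant of `B₃` there is
positive and its index is even. Thus the index of `B₃` has the parity of its index on the
generalized kernel (`even_sigNeg_iff`). It remains to find the parities of the nullity and the index
of `B₃`.

Reduction. `E₃` is `N × MN`, where `N` is the mass-orthogonal complement of the translations and the
split-off rotation directions. Completing the square in the momenta leaves a positive definite form
plus the effective form `-D²U - |K·|²_M` on `N` (`index_formB₃`). For a non-planar equilibrium
`|Kx|²_M = U |x|²_M`, so the effective form is minus the Hessian on `N`. For a planar one this holds
on the part of `N` in the plane of motion. On the normal part the effective form is positive
definite, and the Hessian there is two copies of one form, one for each normal direction. Hence in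
both cases the index of the effective form and the positive index of the Hessian on `N` agree mod 2,
and so do the nullities (`index_parity`).

Counting. The tangent space of the ellipsoid is `N` plus a `(k-1)`-dimensional space of rotations in
the radical of `H(q)`, and `k` and `dim N = 4n - 4 - k` are even. So the nullity of `B₃` is `n⁰ + 1`
mod 2 and its index is `n⁻ + n⁰ + 1` mod 2. If `n⁰` is even the kernel is odd-dimensional, which
forces a Jordan block. If `n⁻ + n⁰` is even the index is odd, which under the assumption on the
generalized kernel forces a nonzero real eigenvalue. In the non-degenerate case `n⁰` is the
dimension of the orbit: 6 for non-planar, 5 for planar non-collinear and 3 for collinear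
configurations. -/

noncomputable section

namespace NBody

open scoped InnerProductSpace

variable {n : ℕ}

/-! ### Index and nullity of quadratic forms restricted to subspaces. -/

section Signature

variable {E E' : Type*} [AddCommGroup E] [Module ℝ E] [AddCommGroup E'] [Module ℝ E']

/-- Orthogonality is phrased throughout as additivity of `Q`, so that no polar form has to be
carried along. -/
lemma mem_radical_restrict (Q : QuadraticForm ℝ E) {U : Submodule ℝ E} (x : U) :
    x ∈ (Q.restrict U).radical ↔ ∀ y ∈ U, Q (x + y) = Q x + Q y := by
  have : Invertible (2 : ℝ) := invertibleOfNonzero two_ne_zero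
  rw [QuadraticMap.radical_eq_ker_polarBilin, LinearMap.mem_ker, LinearMap.ext_iff]
  simp only [QuadraticMap.polarBilin_apply_apply, QuadraticMap.polar, QuadraticMap.restrict_apply,
    LinearMap.zero_apply, Subtype.forall, Submodule.coe_add]
  exact forall₂_congr fun y _ => ⟨fun h => by linarith, fun h => by linarith⟩

/-- A submodule is isomorphic to its image under a linear map that is injective on it. -/
def mapEquivOfInj {S : Submodule ℝ E} (f : E →ₗ[ℝ] E') (hf : ∀ x ∈ S, f x = 0 → x = 0) :
    S ≃ₗ[ℝ] S.map f :=
  (LinearEquiv.ofInjective (f.domRestrict S) (by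
    rw [← LinearMap.ker_eq_bot, LinearMap.ker_eq_bot']
    rintro ⟨x, hx⟩ h
    ext
    exact hf x hx h)).trans (LinearEquiv.ofEq _ _ (by rw [LinearMap.range_domRestrict]))

lemma restrict_equivalent (Q : QuadraticForm ℝ E) (Q' : QuadraticForm ℝ E') {S : Submodule ℝ E}
    (f : E →ₗ[ℝ] E') (hf : ∀ x ∈ S, f x = 0 → x = 0) (hQ : ∀ x ∈ S, Q' (f x) = Q x) :
    QuadraticMap.Equivalent (Q.restrict S) (Q'.restrict (S.map f)) :=
  ⟨⟨mapEquivOfInj f hf, fun x => hQ x x.2⟩⟩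

lemma sig_congr (Q Q' : QuadraticForm ℝ E) {S : Submodule ℝ E} (h : ∀ x ∈ S, Q x = Q' x) :
    Q.restrict S = Q'.restrict S := by
  ext x
  exact h x x.2

variable [FiniteDimensional ℝ E]

lemma finrank_le_sigPos_restrict (Q : QuadraticForm ℝ E) {V U : Submodule ℝ E} (hVU : V ≤ U)
    (h : ∀ x ∈ V, x ≠ 0 → 0 < Q x) : Module.finrank ℝ V ≤ sigPos (Q.restrict U) := by
  have h1 : ((Q.restrict U).restrict (V.comap U.subtype)).PosDef := by
    rintro ⟨⟨x, hxU⟩, hx⟩ hx0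
    exact h x hx fun h0 => hx0 (by ext; exact h0)
  have h2 := le_sigPos_of_posDef _ h1
  rwa [(Submodule.comapSubtypeEquivOfLe hVU).finrank_eq] at h2

lemma exists_finrank_eq_sigPos_restrict (Q : QuadraticForm ℝ E) (U : Submodule ℝ E) :
    ∃ V ≤ U, Module.finrank ℝ V = sigPos (Q.restrict U) ∧ ∀ x ∈ V, x ≠ 0 → 0 < Q x := by
  obtain ⟨V, h1, h2⟩ := exists_finrank_eq_sigPos_and_posDef (Q.restrict U)
  refine ⟨V.map U.subtype, Submodule.map_subtype_le U V, ?_, ?_⟩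
  · rw [← h1]
    exact Submodule.finrank_map_subtype_eq U V
  · rintro _ ⟨x, hx, rfl⟩ h0
    exact h2 ⟨x, hx⟩ fun h => h0 (by
      have h3 := congrArg Subtype.val h
      rw [Submodule.subtype_apply]
      exact congrArg Subtype.val h3)

lemma finrank_le_radical_restrict (Q : QuadraticForm ℝ E) {V U : Submodule ℝ E} (hVU : V ≤ U)
    (h : ∀ x ∈ V, ∀ y ∈ U, Q (x + y) = Q x + Q y) :
    Module.finrank ℝ V ≤ Module.finrank ℝ (Q.restrict U).radical := by
  rw [← (Submodule.comapSubtypeEquivOfLe hVU).finrank_eq]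
  exact Submodule.finrank_mono fun x hx => (mem_radical_restrict Q x).mpr (h x hx)

lemma sig_add_radical_restrict (Q : QuadraticForm ℝ E) (U : Submodule ℝ E) :
    sigPos (Q.restrict U) + sigNeg (Q.restrict U) + Module.finrank ℝ (Q.restrict U).radical
      = Module.finrank ℝ U :=
  QuadraticForm.sigPos_add_sigNeg_add_radical

lemma finrank_sup_of_disjoint {S T : Submodule ℝ E} (hd : Disjoint S T) :
    Module.finrank ℝ (S ⊔ T : Submodule ℝ E) = Module.finrank ℝ S + Module.finrank ℝ T := by
  have := Submodule.finrank_sup_add_finrank_inf_eq S T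
  rwa [disjoint_iff.mp hd, finrank_bot, add_zero] at this

/-- Maximal positive definite subspaces of the two summands add up to a positive definite one. Only
this inequality is needed, as a dimension count in `sig_sup` upgrades it to an equality. -/
lemma sigPos_add_le (Q : QuadraticForm ℝ E) {S T : Submodule ℝ E} (hd : Disjoint S T)
    (hST : ∀ x ∈ S, ∀ y ∈ T, Q (x + y) = Q x + Q y) :
    sigPos (Q.restrict S) + sigPos (Q.restrict T) ≤ sigPos (Q.restrict (S ⊔ T)) := by
  obtain ⟨V, hV, hV1, hV2⟩ := exists_finrank_eq_sigPos_restrict Q S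
  obtain ⟨V', hV', hV1', hV2'⟩ := exists_finrank_eq_sigPos_restrict Q T
  rw [← hV1, ← hV1', ← finrank_sup_of_disjoint (hd.mono hV hV')]
  refine finrank_le_sigPos_restrict Q (sup_le_sup hV hV') fun x hx h0 => ?_
  obtain ⟨y, hy, z, hz, rfl⟩ := Submodule.mem_sup.mp hx
  rw [hST y (hV hy) z (hV' hz)]
  by_cases hy0 : y = 0
  · have hz0 : z ≠ 0 := fun h => h0 (by rw [hy0, h, add_zero])
    rw [hy0, QuadraticMap.map_zero, zero_add]
    exact hV2' z hz hz0
  · by_cases hz0 : z = 0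
    · rw [hz0, QuadraticMap.map_zero, add_zero]
      exact hV2 y hy hy0
    · exact add_pos (hV2 y hy hy0) (hV2' z hz hz0)

/-- The signature and the nullity are additive over orthogonal direct sums. -/
lemma sig_sup (Q : QuadraticForm ℝ E) {S T : Submodule ℝ E} (hd : Disjoint S T)
    (hST : ∀ x ∈ S, ∀ y ∈ T, Q (x + y) = Q x + Q y) :
    sigPos (Q.restrict (S ⊔ T)) = sigPos (Q.restrict S) + sigPos (Q.restrict T) ∧
    sigNeg (Q.restrict (S ⊔ T)) = sigNeg (Q.restrict S) + sigNeg (Q.restrict T) ∧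
    Module.finrank ℝ (Q.restrict (S ⊔ T)).radical =
      Module.finrank ℝ (Q.restrict S).radical + Module.finrank ℝ (Q.restrict T).radical := by
  have h1 := sigPos_add_le Q hd hST
  have h2 : sigNeg (Q.restrict S) + sigNeg (Q.restrict T) ≤ sigNeg (Q.restrict (S ⊔ T)) :=
    sigPos_add_le (-Q) hd fun x hx y hy => by
      simp only [neg_apply, hST x hx y hy]; ring
  have h3 : Module.finrank ℝ (Q.restrict S).radical + Module.finrank ℝ (Q.restrict T).radical ≤
      Module.finrank ℝ (Q.restrict (S ⊔ T)).radical := by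
    have e1 := Submodule.finrank_map_subtype_eq S (Q.restrict S).radical
    have e2 := Submodule.finrank_map_subtype_eq T (Q.restrict T).radical
    have l1 := Submodule.map_subtype_le S (Q.restrict S).radical
    have l2 := Submodule.map_subtype_le T (Q.restrict T).radical
    rw [← e1, ← e2, ← finrank_sup_of_disjoint (hd.mono l1 l2)]
    refine finrank_le_radical_restrict Q (sup_le_sup l1 l2) fun x hx y hy => ?_
    obtain ⟨_, ⟨x1, hx1, rfl⟩, _, ⟨x2, hx2, rfl⟩, rfl⟩ := Submodule.mem_sup.mp hx
    obtain ⟨y1, hy1, y2, hy2, rfl⟩ := Submodule.mem_sup.mp hy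
    have r1 := (mem_radical_restrict Q x1).mp hx1 y1 hy1
    have r2 := (mem_radical_restrict Q x2).mp hx2 y2 hy2
    simp only [Submodule.subtype_apply]
    rw [add_add_add_comm, hST _ (S.add_mem x1.2 hy1) _ (T.add_mem x2.2 hy2), r1, r2,
      hST _ x1.2 _ x2.2, hST _ hy1 _ hy2]
    ring
  -- The three invariants are superadditive and their totals on both sides equal the dimension, so
  -- none of the inequalities is strict.
  have t1 := sig_add_radical_restrict Q S
  have t2 := sig_add_radical_restrict Q T
  have t3 := sig_add_radical_restrict Q (S ⊔ T)
  rw [finrank_sup_of_disjoint hd] at t3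
  omega

lemma sig_of_pos (Q : QuadraticForm ℝ E) {S : Submodule ℝ E} (h : ∀ x ∈ S, x ≠ 0 → 0 < Q x) :
    sigNeg (Q.restrict S) = 0 ∧ Module.finrank ℝ (Q.restrict S).radical = 0 := by
  have h1 := finrank_le_sigPos_restrict Q le_rfl h
  have h2 := sig_add_radical_restrict Q S
  omega

lemma sig_of_zero (Q : QuadraticForm ℝ E) {S : Submodule ℝ E} (h : ∀ x ∈ S, Q x = 0) :
    sigPos (Q.restrict S) = 0 ∧ sigNeg (Q.restrict S) = 0 ∧
      Module.finrank ℝ (Q.restrict S).radical = Module.finrank ℝ S := by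
  have h1 := finrank_le_radical_restrict Q (le_refl S) fun x hx y hy => by
    rw [h x hx, h y hy, h _ (add_mem hx hy), add_zero]
  have h2 := sig_add_radical_restrict Q S
  omega

lemma sig_neg_restrict (Q : QuadraticForm ℝ E) (S : Submodule ℝ E) :
    sigNeg ((-Q).restrict S) = sigPos (Q.restrict S) ∧
      Module.finrank ℝ ((-Q).restrict S).radical = Module.finrank ℝ (Q.restrict S).radical := by
  have e : (-Q).restrict S = -(Q.restrict S) := rfl
  have h1 : sigNeg ((-Q).restrict S) = sigPos (Q.restrict S) := by rw [e, sigNeg_neg]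
  have h2 : sigPos ((-Q).restrict S) = sigNeg (Q.restrict S) := by rw [e, sigPos_neg]
  have h3 := sig_add_radical_restrict Q S
  have h4 := sig_add_radical_restrict (-Q) S
  omega

end Signature

/-! ### Determinants and parity in the absence of real eigenvectors. -/

section Parity

open scoped Matrix

/-- The segment from the identity to `A` stays in the invertible matrices, so the determinant keeps
the sign it has at the identity. -/
lemma det_pos_of_no_real_eigenvector {ι : Type*} [Fintype ι] [DecidableEq ι] (A : Matrix ι ι ℝ)
    (h : ∀ (c : ℝ) (v : ι → ℝ), A.mulVec v = c • v → v = 0) : 0 < A.det := by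
  set f : ℝ → ℝ := fun t => ((1 - t) • (1 : Matrix ι ι ℝ) + t • A).det with hf
  have hc : Continuous f := by
    rw [hf]
    refine Continuous.matrix_det ?_
    fun_prop
  have h0 : f 0 = 1 := by simp [hf]
  have h1 : f 1 = A.det := by simp [hf]
  have hne : ∀ t, f t ≠ 0 := by
    intro t ht
    obtain ⟨v, hv, hv2⟩ := Matrix.exists_mulVec_eq_zero_iff.mpr ht
    by_cases ht0 : t = 0
    · rw [ht0, h0] at ht
      exact one_ne_zero ht
    -- A kernel vector of `(1 - t) I + t A` is an eigenvector of `A` with this eigenvalue.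
    · refine hv (h ((t - 1) / t) v ?_)
      rw [Matrix.add_mulVec, Matrix.smul_mulVec, Matrix.smul_mulVec, Matrix.one_mulVec] at hv2
      have h3 : t • A.mulVec v = (t - 1) • v := by
        rw [← sub_eq_zero, ← hv2]; module
      rw [div_eq_inv_mul, mul_smul, ← h3, smul_smul, inv_mul_cancel₀ ht0, one_smul]
  by_contra hneg
  rw [← h1] at hneg
  obtain ⟨t, -, ht⟩ := intermediate_value_Icc' (zero_le_one (α := ℝ)) hc.continuousOn
    (show (0 : ℝ) ∈ Set.Icc (f 1) (f 0) from ⟨not_lt.mp hneg, by rw [h0]; exact zero_le_one⟩)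
  exact hne t ht

/-- Both `det A` and `det (-A) = (-1)^d det A` are positive. -/
lemma even_card_of_no_real_eigenvector {ι : Type*} [Fintype ι] [DecidableEq ι] (A : Matrix ι ι ℝ)
    (h : ∀ (c : ℝ) (v : ι → ℝ), A.mulVec v = c • v → v = 0) : Even (Fintype.card ι) := by
  have h1 := det_pos_of_no_real_eigenvector A h
  have h2 := det_pos_of_no_real_eigenvector (-A) fun c v hv => h (-c) v (by
    rw [Matrix.neg_mulVec] at hv
    rw [neg_smul, ← hv, neg_neg])
  rw [Matrix.det_neg] at h2
  by_contra hodd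
  rw [Nat.not_even_iff_odd] at hodd
  rw [hodd.neg_one_pow] at h2
  linarith

variable {E : Type*} [AddCommGroup E] [Module ℝ E]

/-- For the Gram matrix `Ω`, skewness gives `0 = uᵀΩu = c |u|²`; the case `c = 0` is excluded by
non-degeneracy. Through the two preceding lemmas this yields that `det Ω` is positive and that
symplectic spaces have even dimension. -/
lemma skewForm_no_real_eigenvector (ω : LinearMap.BilinForm ℝ E) (hs : ∀ x y, ω x y = -ω y x)
    (hω : ∀ x, (∀ y, ω x y = 0) → x = 0) {ι : Type*} [Fintype ι] [DecidableEq ι]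
    (v : Module.Basis ι ℝ E) (c : ℝ) (u : ι → ℝ)
    (hu : (LinearMap.BilinForm.toMatrix v ω).mulVec u = c • u) : u = 0 := by
  have hself : ∀ x, ω x x = 0 := fun x => by have := hs x x; linarith
  have key : ∀ w : ι → ℝ, ω (v.equivFun.symm w) (v.equivFun.symm u) = w ⬝ᵥ (c • u) := by
    intro w
    rw [← hu, LinearMap.BilinForm.apply_eq_dotProduct_toMatrix_mulVec v]
    have h : ∀ a : ι → ℝ, ⇑(v.repr (v.equivFun.symm a)) = a := v.equivFun.apply_symm_apply
    rw [h, h]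
  have h1 := key u
  rw [hself, dotProduct_smul, eq_comm, smul_eq_mul, mul_eq_zero] at h1
  rcases h1 with h1 | h1
  · have h2 : v.equivFun.symm u = 0 := hω _ fun y => by
      rw [hs, ← v.equivFun.symm_apply_apply y, key, h1]
      simp
    exact (LinearEquiv.map_eq_zero_iff _).mp h2
  · exact dotProduct_self_eq_zero.mp h1

variable [FiniteDimensional ℝ E]

lemma even_finrank_of_skewForm (ω : LinearMap.BilinForm ℝ E) (hs : ∀ x y, ω x y = -ω y x)
    (hω : ∀ x, (∀ y, ω x y = 0) → x = 0) : Even (Module.finrank ℝ E) := by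
  have v := Module.finBasis ℝ E
  simpa using even_card_of_no_real_eigenvector _ fun c u hu =>
    skewForm_no_real_eigenvector ω hs hω v c u hu

lemma even_sigNeg_of_prod_pos {d : ℕ} (w : Fin d → ℝ) (h : 0 < ∏ i, w i) :
    Even ({i | w i < 0} : Set (Fin d)).ncard := by
  classical
  have h1 : ∏ i, w i = (-1) ^ (Finset.univ.filter fun i => w i < 0).card * ∏ i, |w i| := by
    rw [← Finset.prod_const, Finset.prod_filter, ← Finset.prod_mul_distrib]
    refine Finset.prod_congr rfl fun i _ => ?_
    split_ifs with hi
    · rw [abs_of_neg hi]; ring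
    · rw [abs_of_nonneg (not_lt.mp hi)]; ring
  have h2 : 0 ≤ ∏ i, |w i| := Finset.prod_nonneg fun i _ => abs_nonneg _
  rw [Set.ncard_eq_toFinset_card', Set.toFinset_ofPred]
  by_contra hodd
  rw [Nat.not_even_iff_odd] at hodd
  rw [hodd.neg_one_pow] at h1
  linarith

/-- The Hamiltonian form of an infinitesimally symplectic map without real eigenvalues has even
index. -/
lemma even_sigNeg_of_no_real_eigenvector (ω : LinearMap.BilinForm ℝ E)
    (hs : ∀ x y, ω x y = -ω y x) (hω : ∀ x, (∀ y, ω x y = 0) → x = 0) (A : Module.End ℝ E)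
    (hA : ∀ x y, ω x (A y) = -ω (A x) y) (hev : ∀ (c : ℝ) x, A x = c • x → x = 0)
    (Q : QuadraticForm ℝ E) (hQ : ∀ x, Q x = -ω (A x) x) : Even (sigNeg Q) := by
  have : Invertible (2 : ℝ) := invertibleOfNonzero two_ne_zero
  obtain ⟨v, hv⟩ := LinearMap.BilinForm.exists_orthogonal_basis 
    (QuadraticForm.associated_isSymm ℝ Q)
  have hassoc : ∀ x y, QuadraticMap.associated Q x y = -ω (A x) y := by
    intro x y
    have h1 : ω (A y) x = ω (A x) y := by rw [hs, hA, neg_neg]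
    have h2 := congrArg (fun B => B x y) (QuadraticMap.two_nsmul_associated ℝ Q)
    simp only [LinearMap.smul_apply, QuadraticMap.polarBilin_apply_apply, QuadraticMap.polar, hQ,
      map_add, LinearMap.add_apply, h1, nsmul_eq_mul, Nat.cast_ofNat] at h2
    linarith
  rw [QuadraticForm.sigNeg_of_equiv_weightedSumSquares
    ⟨Q.isometryEquivWeightedSumSquares v hv⟩]
  refine even_sigNeg_of_prod_pos _ ?_
  have hΩ := det_pos_of_no_real_eigenvector _ fun c u hu =>
    skewForm_no_real_eigenvector ω hs hω v c u hu
  have hAm : ∀ (c : ℝ) (u : Fin _ → ℝ), (LinearMap.toMatrix v v A).mulVec u = c • u → u = 0 := by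
    intro c u hu
    have h2 : A (v.equivFun.symm u) = c • v.equivFun.symm u := by
      apply v.equivFun.injective
      rw [map_smul, LinearEquiv.apply_symm_apply, ← hu]
      have := LinearMap.toMatrix_mulVec_repr v v A (v.equivFun.symm u)
      have h : ⇑(v.repr (v.equivFun.symm u)) = u := v.equivFun.apply_symm_apply u
      rw [h] at this
      exact this.symm
    exact (LinearEquiv.map_eq_zero_iff _).mp (hev c _ h2)
  have hA0 := det_pos_of_no_real_eigenvector _ hAm
  have hev2 := even_card_of_no_real_eigenvector _ hAm
  -- In a `Q`-orthogonal basis the Gram matrix of `Q` is diagonal, and it is also `-AᵀΩ`.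
  have hmat : Matrix.diagonal (fun i => Q (v i)) =
      -((LinearMap.toMatrix v v A).transpose * LinearMap.BilinForm.toMatrix v ω) := by
    have e1 : LinearMap.BilinForm.toMatrix v (ω.compLeft A) =
        (LinearMap.toMatrix v v A).transpose * LinearMap.BilinForm.toMatrix v ω :=
      LinearMap.BilinForm.toMatrix_compLeft v ω A
    rw [← e1]
    ext i j
    rw [Matrix.neg_apply, LinearMap.BilinForm.toMatrix_apply]
    by_cases hij : i = j
    · subst hij
      rw [Matrix.diagonal_apply_eq, hQ]; rfl
    · rw [Matrix.diagonal_apply_ne _ hij]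
      have h3 := hv hij
      have h4 : QuadraticMap.associated Q (v i) (v j) = 0 := h3
      rw [hassoc] at h4
      exact h4.symm
  -- The sign `(-1)^d` disappears because the dimension is even.
  rw [← Matrix.det_diagonal, hmat, Matrix.det_neg, hev2.neg_one_pow, one_mul, Matrix.det_mul,
    Matrix.det_transpose]
  exact mul_pos hA0 hΩ

end Parity

/-! ### Infinitesimally symplectic maps: generalized kernel, Jordan blocks and index. -/

section Hamiltonian

open scoped TensorProduct

variable {E : Type*} [AddCommGroup E] [Module ℝ E]
  (ω : LinearMap.BilinForm ℝ E) (A : Module.End ℝ E)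

lemma symp_pow (hA : ∀ x y, ω x (A y) = -ω (A x) y) (e : ℕ) :
    ∀ x y, ω x ((A ^ e) y) = (-1) ^ e * ω ((A ^ e) x) y := by
  induction e with
  | zero => simp
  | succ e ih =>
    intro x y
    have h : (A ^ (e + 1)) x = (A ^ e) (A x) := by rw [pow_succ, Module.End.mul_apply]
    rw [h, pow_succ', Module.End.mul_apply, hA, ih, pow_succ]
    ring

/-- Up to sign `A ^ e` is its own symplectic adjoint, so its kernel and range are symplectically
orthogonal. When they are complementary, each is therefore a symplectic subspace. -/
lemma symp_ker_range (hA : ∀ x y, ω x (A y) = -ω (A x) y) (e : ℕ) {x y : E}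
    (hx : x ∈ LinearMap.ker (A ^ e)) (hy : y ∈ LinearMap.range (A ^ e)) : ω x y = 0 := by
  obtain ⟨z, rfl⟩ := hy
  rw [symp_pow ω A hA, LinearMap.mem_ker.mp hx]
  simp

lemma nondegenerate_range (hs : ∀ x y, ω x y = -ω y x) (hω : ∀ x, (∀ y, ω x y = 0) → x = 0)
    (hA : ∀ x y, ω x (A y) = -ω (A x) y) (e : ℕ)
    (hc : IsCompl (LinearMap.ker (A ^ e)) (LinearMap.range (A ^ e))) {x : E}
    (hx : x ∈ LinearMap.range (A ^ e)) (h : ∀ y ∈ LinearMap.range (A ^ e), ω x y = 0) :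
    x = 0 := by
  refine hω x fun y => ?_
  obtain ⟨y1, h1, y2, h2, rfl⟩ := Submodule.mem_sup.mp
    (hc.sup_eq_top ▸ Submodule.mem_top : y ∈ LinearMap.ker (A ^ e) ⊔ LinearMap.range (A ^ e))
  rw [map_add, h y2 h2, hs, symp_ker_range ω A hA e h1 hx, neg_zero, add_zero]

/-- A real eigenvector `x` yields the eigenvector `1 ⊗ x` of the complexification, whose real
eigenvalue `c` would have to be purely imaginary. -/
lemma no_real_eigenvalue_of_complex
    (h : ∀ μ : ℂ, Module.End.HasEigenvalue (A.baseChange ℂ) μ → μ.re = 0) (c : ℝ) (x : E)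
    (hc : c ≠ 0) (hx : A x = c • x) : x = 0 := by
  by_contra hx0
  refine hc (h (c : ℂ) (Module.End.hasEigenvalue_of_hasEigenvector
    (x := (1 : ℂ) ⊗ₜ[ℝ] x) ⟨?_, ?_⟩))
  · rw [Module.End.mem_eigenspace_iff, LinearMap.baseChange_tmul, hx, TensorProduct.tmul_smul,
      TensorProduct.smul_tmul', TensorProduct.smul_tmul']
    simp
  · intro h0
    exact hx0 (by simpa using h0)

/-- Split `1 ⊗ x` into a part `k` in the eigenspace of `0` and a part `r` in the sum of the other
eigenspaces. If `A² x = 0`, then `r` is also a generalized eigenvector for `0`, so `r = 0` by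
independence. -/
lemma ker_sq_le_of_diagonalizable
    (h : ⨆ μ : ℂ, Module.End.eigenspace (A.baseChange ℂ) μ = ⊤) :
    LinearMap.ker (A ^ 2) ≤ LinearMap.ker A := by
  intro x hx
  set f := A.baseChange ℂ with hf
  have hle : ∀ μ : ℂ, Module.End.eigenspace f μ ≤ Module.End.maxGenEigenspace f μ :=
    fun μ => (Module.End.genEigenspace f μ).mono le_top
  have hx1 : (1 : ℂ) ⊗ₜ[ℝ] x ∈ Module.End.maxGenEigenspace f 0 := by
    rw [Module.End.mem_maxGenEigenspace]
    refine ⟨2, ?_⟩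
    rw [LinearMap.mem_ker, pow_two, Module.End.mul_apply] at hx
    rw [zero_smul, sub_zero, pow_two, Module.End.mul_apply, hf, LinearMap.baseChange_tmul,
      LinearMap.baseChange_tmul, hx, TensorProduct.tmul_zero]
  have hmem : (1 : ℂ) ⊗ₜ[ℝ] x ∈
      Module.End.eigenspace f 0 ⊔ ⨆ μ : ℂ, ⨆ _ : μ ≠ 0, Module.End.eigenspace f μ := by
    have h1 : ⨆ μ : ℂ, Module.End.eigenspace f μ ≤
        Module.End.eigenspace f 0 ⊔ ⨆ μ : ℂ, ⨆ _ : μ ≠ 0, Module.End.eigenspace f μ := by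
      refine iSup_le fun μ => ?_
      by_cases hμ : μ = 0
      · rw [hμ]; exact le_sup_left
      · exact le_sup_of_le_right (le_iSup₂_of_le μ hμ le_rfl)
    rw [h] at h1
    exact h1 Submodule.mem_top
  obtain ⟨k, hk, r, hr, hkr⟩ := Submodule.mem_sup.mp hmem
  have hr1 : r ∈ ⨆ μ : ℂ, ⨆ _ : μ ≠ 0, Module.End.maxGenEigenspace f μ :=
    (iSup₂_mono fun μ _ => hle μ) hr
  have hr2 : r ∈ Module.End.maxGenEigenspace f 0 := by
    have : r = (1 : ℂ) ⊗ₜ[ℝ] x - k := by rw [← hkr, add_sub_cancel_left]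
    rw [this]
    exact sub_mem hx1 (hle 0 hk)
  have hr0 : r = 0 :=
    Submodule.disjoint_def.mp (Module.End.independent_maxGenEigenspace f 0) r hr2 hr1
  rw [hr0, add_zero] at hkr
  rw [hkr, Module.End.mem_eigenspace_iff, zero_smul, hf, LinearMap.baseChange_tmul] at hk
  simpa using hk

/-- The polar form of `Q` is `-2 ω(A x, y)`, and `ω` is non-degenerate. -/
lemma radical_eq_ker (hs : ∀ x y, ω x y = -ω y x) (hω : ∀ x, (∀ y, ω x y = 0) → x = 0)
    (hA : ∀ x y, ω x (A y) = -ω (A x) y) (Q : QuadraticForm ℝ E) (hQ : ∀ x, Q x = -ω (A x) x) :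
    Q.radical = LinearMap.ker A := by
  have : Invertible (2 : ℝ) := invertibleOfNonzero two_ne_zero
  have h1 : ∀ x y, ω (A y) x = ω (A x) y := fun x y => by rw [hs, hA, neg_neg]
  ext x
  rw [QuadraticMap.radical_eq_ker_polarBilin, LinearMap.mem_ker, LinearMap.ext_iff,
    LinearMap.mem_ker]
  simp only [QuadraticMap.polarBilin_apply_apply, QuadraticMap.polar, LinearMap.zero_apply, hQ,
    map_add, LinearMap.add_apply, h1 x]
  exact ⟨fun h => hω _ fun y => by linarith [h y], fun h y => by rw [h]; simp⟩

variable [FiniteDimensional ℝ E]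

/-- Without a Jordan block at `0`, kernel and range are complementary. The range and the whole space
are symplectic, hence even-dimensional, and so is the kernel by rank and nullity. -/
lemma even_finrank_ker (hs : ∀ x y, ω x y = -ω y x) (hω : ∀ x, (∀ y, ω x y = 0) → x = 0)
    (hA : ∀ x y, ω x (A y) = -ω (A x) y)
    (h : LinearMap.ker (A ^ 2) ≤ LinearMap.ker A) : Even (Module.finrank ℝ (LinearMap.ker A)) := by
  have hd : Disjoint (LinearMap.ker A) (LinearMap.range A) := by
    rw [Submodule.disjoint_def]
    rintro _ h1 ⟨y, rfl⟩
    exact h (by rw [LinearMap.mem_ker, pow_two]; exact h1)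
  have hc : IsCompl (LinearMap.ker A) (LinearMap.range A) := by
    refine ⟨hd, codisjoint_iff.mpr (Submodule.eq_top_of_finrank_eq ?_)⟩
    rw [finrank_sup_of_disjoint hd, add_comm, LinearMap.finrank_range_add_finrank_ker]
  have h1 := even_finrank_of_skewForm (ω.domRestrict₁₂ (LinearMap.range A) (LinearMap.range A))
    (fun x y => hs x y) fun x hx => by
      ext
      have := nondegenerate_range ω A hs hω hA 1 (by simpa using hc) (x := x)
        (by rw [pow_one]; exact x.2)
        (fun y hy => hx ⟨y, by rwa [pow_one] at hy⟩)
      exact this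
  have h2 := even_finrank_of_skewForm ω hs hω
  have h3 := LinearMap.finrank_range_add_finrank_ker A
  rw [← h3, Nat.even_add] at h2
  exact h2.mp h1

/-- Without nonzero real eigenvalues, the parity of the index is that of the index on the
generalized kernel. -/
lemma even_sigNeg_iff (hs : ∀ x y, ω x y = -ω y x) (hω : ∀ x, (∀ y, ω x y = 0) → x = 0)
    (hA : ∀ x y, ω x (A y) = -ω (A x) y) (hev : ∀ (c : ℝ) x, c ≠ 0 → A x = c • x → x = 0)
    (Q : QuadraticForm ℝ E) (hQ : ∀ x, Q x = -ω (A x) x) {e : ℕ} (he : e = Module.finrank ℝ E) :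
    Even (sigNeg Q) ↔ Even (sigNeg (Q.restrict (LinearMap.ker (A ^ e)))) := by
  set G := LinearMap.ker (A ^ e) with hG
  set F := LinearMap.range (A ^ e) with hF
  -- The kernels of the powers are stationary from the exponent `dim E` on, which gives the Fitting
  -- decomposition `E = G ⊕ F`.
  have hker : LinearMap.ker (A ^ (e + e)) = G := by
    rw [hG, he]
    exact Module.End.ker_pow_eq_ker_pow_finrank_of_le (by omega)
  have hd : Disjoint G F := by
    rw [Submodule.disjoint_def]
    rintro _ h1 ⟨y, rfl⟩
    have : y ∈ G := by
      rw [← hker, LinearMap.mem_ker, pow_add]; exact h1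
    exact this
  have hc : IsCompl G F := by
    refine ⟨hd, codisjoint_iff.mpr (Submodule.eq_top_of_finrank_eq ?_)⟩
    rw [finrank_sup_of_disjoint hd, add_comm, LinearMap.finrank_range_add_finrank_ker]
  have hAF : ∀ x ∈ F, A x ∈ F := by
    rintro _ ⟨y, rfl⟩
    exact ⟨A y, by rw [← Module.End.mul_apply, ← Module.End.mul_apply, ← pow_succ, ← pow_succ']⟩
  have hadd := (sig_sup Q hd fun x hx y hy => by
    have h1 : ω x (A y) = 0 := symp_ker_range ω A hA e hx (hAF y hy)
    have h2 : ω (A x) y = 0 := by rw [← neg_eq_zero, ← hA, h1]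
    have h3 : ω (A y) x = 0 := by rw [hs, h1, neg_zero]
    rw [hQ, hQ, hQ]
    simp only [map_add, LinearMap.add_apply, h2, h3]
    ring).2.1
  have htop : sigNeg (Q.restrict (G ⊔ F)) = sigNeg Q := by
    rw [hc.sup_eq_top]
    exact QuadraticMap.Equivalent.sigNeg_eq ⟨⟨Submodule.topEquiv, fun x => rfl⟩⟩
  have hevF : Even (sigNeg (Q.restrict F)) := by
    refine even_sigNeg_of_no_real_eigenvector (ω.domRestrict₁₂ F F) (fun x y => hs x y)
      (fun x hx => ?_) (A.restrict hAF) (fun x y => hA x y) (fun c x hx => ?_) _ fun x => hQ x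
    · ext
      exact nondegenerate_range ω A hs hω hA e hc x.2 fun y hy => hx ⟨y, hy⟩
    · have hx' : A x = c • (x : E) := congrArg Subtype.val hx
      ext
      -- The eigenvalue `0` does not occur on `F` either: its eigenvectors lie in `G`, which meets
      -- `F` trivially.
      by_cases hc0 : c = 0
      · rw [hc0, zero_smul] at hx'
        have h1 : (x : E) ∈ LinearMap.ker (A ^ (e + 1)) := by
          rw [LinearMap.mem_ker, pow_succ, Module.End.mul_apply, hx', map_zero]
        have h2 : (x : E) ∈ G := by
          rw [← hker]
          -- The splitting of the exponent below uses `e - 1`, so `e = 0`, where the space is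
          -- trivial, is treated apart.
          rcases Nat.eq_zero_or_pos e with h0 | h0
          · have : Subsingleton E := by
              rw [← Module.finrank_zero_iff (R := ℝ), ← he, h0]
            rw [Subsingleton.elim (x : E) 0]
            exact zero_mem _
          · rw [LinearMap.mem_ker, show e + e = (e - 1) + (e + 1) by omega, pow_add,
              Module.End.mul_apply, LinearMap.mem_ker.mp h1, map_zero]
        exact (Submodule.disjoint_def.mp hd) _ h2 x.2
      · exact hev c x hc0 hx'
  rw [← htop, hadd, Nat.even_add]
  exact ⟨fun h => h.mpr hevF, fun h => ⟨fun _ => hevF, fun _ => h⟩⟩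

end Hamiltonian

/-! ### The mass scalar product. -/

section Mass

lemma inner_massMatrix_self (m : Fin n → ℝ) (x : Config n) :
    ⟪massMatrix m x, x⟫_ℝ = ∑ i, m i * ‖x i‖ ^ 2 := by
  simp [inner_config, scaleBodies, inner_smul_left]

lemma inner_massMatrix_self_pos {m : Fin n → ℝ} (hm : ∀ i, 0 < m i) {x : Config n} (hx : x ≠ 0) :
    0 < ⟪massMatrix m x, x⟫_ℝ := by
  rw [inner_massMatrix_self]
  obtain ⟨i, hi⟩ : ∃ i, x i ≠ 0 := by
    by_contra! h
    exact hx (by ext1 i; exact h i)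
  exact Finset.sum_pos' (fun i _ => mul_nonneg (hm i).le (sq_nonneg _))
    ⟨i, Finset.mem_univ _, mul_pos (hm i) (pow_pos (norm_pos_iff.mpr hi) 2)⟩

lemma eq_zero_of_inner_massMatrix_self {m : Fin n → ℝ} (hm : ∀ i, 0 < m i) {x : Config n}
    (hx : ⟪massMatrix m x, x⟫_ℝ = 0) : x = 0 := by
  by_contra h
  exact (inner_massMatrix_self_pos hm h).ne' hx

lemma massMatrixInv_massMatrix {m : Fin n → ℝ} (hm : ∀ i, 0 < m i) (x : Config n) :
    massMatrixInv m (massMatrix m x) = x := by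
  ext1 i; simp [scaleBodies, smul_smul, (hm i).ne']

lemma massMatrix_massMatrixInv {m : Fin n → ℝ} (hm : ∀ i, 0 < m i) (x : Config n) :
    massMatrix m (massMatrixInv m x) = x := by
  ext1 i; simp [scaleBodies, smul_smul, (hm i).ne']

lemma massMatrix_injective {m : Fin n → ℝ} (hm : ∀ i, 0 < m i) :
    Function.Injective (massMatrix m) :=
  Function.LeftInverse.injective (massMatrixInv_massMatrix hm)

lemma inner_massMatrix_translation (m : Fin n → ℝ) (v : E4) (x : Config n) :
    ⟪massMatrix m (WithLp.toLp 2 fun _ => v), x⟫_ℝ = ⟪v, ∑ i, m i • x i⟫_ℝ := by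
  simp [inner_config, scaleBodies, inner_smul_left, inner_smul_right, inner_sum]

end Mass

/-! ### Positivity and second derivative of the Newtonian potential. -/

section Potential

lemma IsCentralConfiguration.ne_zero {m : Fin n → ℝ} {q : Config n}
    (hq : IsCentralConfiguration m q) : q ≠ 0 := by
  rintro rfl
  have := hq.normalized
  simp at this

lemma potential_pos (hn : 3 ≤ n) {m : Fin n → ℝ} (hm : ∀ i, 0 < m i) {q : Config n}
    (hq : IsCentralConfiguration m q) : 0 < potential m q := by
  have h : ∀ i j, 0 ≤ m i * m j / ‖q i - q j‖ := fun i j =>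
    div_nonneg (mul_pos (hm i) (hm j)).le (norm_nonneg _)
  let i0 : Fin n := ⟨0, by omega⟩
  let i1 : Fin n := ⟨1, by omega⟩
  have h01 : i1 ∈ Finset.Ioi i0 := by
    rw [Finset.mem_Ioi]; exact Nat.zero_lt_one
  refine Finset.sum_pos' (fun i _ => Finset.sum_nonneg fun j _ => h i j)
    ⟨i0, Finset.mem_univ _, Finset.sum_pos' (fun j _ => h i0 j) ⟨i1, h01, ?_⟩⟩
  exact div_pos (mul_pos (hm _) (hm _))
    (norm_pos_iff.mpr (sub_ne_zero_of_mem_Ioi hq.collisionFree h01))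

lemma angularSpeed_sq (hn : 3 ≤ n) {m : Fin n → ℝ} (hm : ∀ i, 0 < m i) {q : Config n}
    (hq : IsCentralConfiguration m q) : angularSpeed m q * angularSpeed m q = potential m q := by
  unfold angularSpeed
  rw [hq.normalized, div_one, Real.mul_self_sqrt (potential_pos hn hm hq).le]

lemma angularSpeed_ne_zero (hn : 3 ≤ n) {m : Fin n → ℝ} (hm : ∀ i, 0 < m i) {q : Config n}
    (hq : IsCentralConfiguration m q) : angularSpeed m q ≠ 0 := by
  intro h
  have := angularSpeed_sq hn hm hq
  rw [h, mul_zero] at this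
  exact (potential_pos hn hm hq).ne this

lemma hasDerivAt_inner_div_norm_cube {a : E4} (ha : a ≠ 0) (b c : E4) :
    HasDerivAt (fun t : ℝ => ⟪a + t • b, c⟫_ℝ / ‖a + t • b‖ ^ 3)
      (⟪b, c⟫_ℝ / ‖a‖ ^ 3 - 3 * ⟪a, b⟫_ℝ * ⟪a, c⟫_ℝ / ‖a‖ ^ 5) 0 := by
  have hn : ‖a‖ ≠ 0 := norm_ne_zero_iff.mpr ha
  have h1 := (hasDerivAt_div_norm 1 ha b).pow 3
  have h2 : HasDerivAt (fun t : ℝ => ⟪a + t • b, c⟫_ℝ) ⟪b, c⟫_ℝ 0 := by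
    have : (fun t : ℝ => ⟪a + t • b, c⟫_ℝ) = fun t : ℝ => ⟪a, c⟫_ℝ + t * ⟪b, c⟫_ℝ := by
      ext t; rw [inner_add_left, inner_smul_left]; rfl
    rw [this]
    simpa using ((hasDerivAt_id (0 : ℝ)).mul_const ⟪b, c⟫_ℝ).const_add ⟪a, c⟫_ℝ
  refine ((h2.mul h1).congr_deriv ?_).congr_of_eventuallyEq (Filter.Eventually.of_forall fun t => ?_)
  · simp only [zero_smul, add_zero, Pi.pow_apply, Nat.reduceSub]
    field_simp
    push_cast
    ring
  · simp [div_eq_mul_inv]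

/-- The second derivative of the Newtonian potential. -/
lemma inner_hessU (m : Fin n → ℝ) {x : Config n} (hx : ∀ i j, i ≠ j → x i ≠ x j)
    (v w : Config n) : ⟪hessU m x v, w⟫_ℝ = ∑ i, ∑ j ∈ Finset.Ioi i,
      -(m i * m j * (⟪v i - v j, w i - w j⟫_ℝ / ‖x i - x j‖ ^ 3
        - 3 * ⟪x i - x j, v i - v j⟫_ℝ * ⟪x i - x j, w i - w j⟫_ℝ / ‖x i - x j‖ ^ 5)) := by
  have hf := contDiffAt_potential m hx
  have hd := (hf.fderiv_right (m := 1) (by norm_num)).differentiableAt (by norm_num)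
  have h0 : ⟪hessU m x v, w⟫_ℝ = fderiv ℝ (fderiv ℝ (potential m)) x v w :=
    inner_fderiv_gradient hf v w
  rw [h0]
  have h1 := (hd.hasFDerivAt.clm_apply (hasFDerivAt_const w x)).hasLineDerivAt v
  simp only [add_apply, ContinuousLinearMap.comp_apply,
    ContinuousLinearMap.flip_apply, zero_apply, map_zero, zero_add] at h1
  have h2 : HasDerivAt (fun t : ℝ => fderiv ℝ (potential m) (x + t • v) w)
      (∑ i, ∑ j ∈ Finset.Ioi i,
      -(m i * m j * (⟪v i - v j, w i - w j⟫_ℝ / ‖x i - x j‖ ^ 3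
        - 3 * ⟪x i - x j, v i - v j⟫_ℝ * ⟪x i - x j, w i - w j⟫_ℝ / ‖x i - x j‖ ^ 5))) 0 := by
    have hcont : Continuous fun t : ℝ => x + t • v := by fun_prop
    -- Being collision free is an open condition, so the formula for the first derivative holds
    -- along the line for small `t`.
    have hev : ∀ᶠ t in nhds (0 : ℝ), ∀ i j, i ≠ j → (x + t • v) i ≠ (x + t • v) j :=
      hcont.continuousAt.eventually_mem (isOpen_collisionFree.mem_nhds (by simpa using hx))
    have h3 : HasDerivAt (fun t : ℝ => ∑ i, ∑ j ∈ Finset.Ioi i,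
        -(m i * m j * (⟪(x i - x j) + t • (v i - v j), w i - w j⟫_ℝ
          / ‖(x i - x j) + t • (v i - v j)‖ ^ 3))) (∑ i, ∑ j ∈ Finset.Ioi i,
      -(m i * m j * (⟪v i - v j, w i - w j⟫_ℝ / ‖x i - x j‖ ^ 3
        - 3 * ⟪x i - x j, v i - v j⟫_ℝ * ⟪x i - x j, w i - w j⟫_ℝ / ‖x i - x j‖ ^ 5))) 0 :=
      HasDerivAt.fun_sum fun i _ => HasDerivAt.fun_sum fun j hj =>
        ((hasDerivAt_inner_div_norm_cube (sub_ne_zero_of_mem_Ioi hx hj) _ _).const_mul _).neg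
    refine h3.congr_of_eventuallyEq ?_
    filter_upwards [hev] with t ht
    rw [fderiv_potential m ht]
    refine Finset.sum_congr rfl fun i _ => Finset.sum_congr rfl fun j _ => ?_
    have h4 : (x + t • v) i - (x + t • v) j = x i - x j + t • (v i - v j) := by
      simp only [PiLp.add_apply, PiLp.smul_apply, smul_sub]
      abel
    rw [h4, mul_div_assoc]
  exact HasDerivAt.unique h1 h2

end Potential

/-! ### Infinitesimal rotations and the dimension of the orbit. -/

section Skew

/-- The rank one map `x ↦ ⟨f, x⟩ g`. -/
def rankOne (f g : E4) : E4 →ₗ[ℝ] E4 := (innerₗ E4 f).smulRight g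

lemma rankOne_apply (f g x : E4) : rankOne f g x = ⟪f, x⟫_ℝ • g := rfl

lemma inner_rankOne (f g x y : E4) : ⟪rankOne f g x, y⟫_ℝ = ⟪x, rankOne g f y⟫_ℝ := by
  simp only [rankOne_apply, inner_smul_left, inner_smul_right, conj_trivial]
  rw [real_inner_comm f x]; ring

lemma rankOne_rankOne {g : E4} (hg : ⟪g, g⟫_ℝ = 1) (f h x : E4) :
    rankOne g h (rankOne f g x) = rankOne f h x := by
  simp only [rankOne_apply, inner_smul_right, hg, mul_one]

/-- The infinitesimal rotation `x ↦ ⟨u, x⟩ f - ⟨f, x⟩ u`. -/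
def wedge (u f : E4) : E4 →ₗ[ℝ] E4 := rankOne u f - rankOne f u

lemma wedge_skew (u f : E4) : IsSkew (wedge u f) := by
  intro x y
  simp only [wedge, LinearMap.sub_apply, inner_sub_left, inner_sub_right, inner_rankOne]
  ring

/-- Converse of `orbitTangent_eq`. Together they replace matrices of `so(4)` by coordinate-free skew
maps. -/
lemma mem_orbitTangent_of_skew (q : Config n) {a : E4 →ₗ[ℝ] E4} (ha : IsSkew a) :
    blockDiag n a q ∈ orbitTangent q := by
  refine Submodule.subset_span ⟨Matrix.toEuclideanLin.symm a, ?_, ?_⟩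
  · rw [LieAlgebra.Orthogonal.mem_so]
    ext i j
    have h := ha (EuclideanSpace.single i 1) (EuclideanSpace.single j 1)
    have h2 : ∀ k l, Matrix.toEuclideanLin.symm a k l =
        ⟪EuclideanSpace.single k (1 : ℝ), a (EuclideanSpace.single l 1)⟫_ℝ := by
      intro k l
      conv_rhs => rw [← Matrix.toEuclideanLin.apply_symm_apply a]
      rw [EuclideanSpace.inner_single_left, Matrix.toLpLin_apply]
      simp
    rw [Matrix.transpose_apply, Matrix.neg_apply, h2, h2, ← h, real_inner_comm]
  · rw [act, LinearEquiv.apply_symm_apply]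

lemma blockDiag_apply (A : E4 →ₗ[ℝ] E4) (x : Config n) (i : Fin n) :
    blockDiag n A x i = A (x i) := rfl

/-- The rank of the configuration. -/
abbrev configSpan (q : Config n) : Submodule ℝ E4 := Submodule.span ℝ (Set.range q)

lemma mem_configSpan (q : Config n) (i : Fin n) : q i ∈ configSpan q :=
  Submodule.subset_span ⟨i, rfl⟩

lemma exists_adapted_basis (S : Submodule ℝ E4) :
    ∃ b : OrthonormalBasis (Fin 4) ℝ E4, (∀ i, i.val < Module.finrank ℝ S → b i ∈ S) ∧
      ∀ i, ¬ i.val < Module.finrank ℝ S → ∀ x ∈ S, ⟪b i, x⟫_ℝ = 0 := by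
  set r := Module.finrank ℝ S with hr
  let w := stdOrthonormalBasis ℝ S
  let v : Fin 4 → E4 := fun i => if h : i.val < r then (w ⟨i, h⟩ : E4) else 0
  have hv : Orthonormal ℝ (Set.domRestrict {i : Fin 4 | i.val < r} v) := by
    have h1 : Orthonormal ℝ fun k : Fin r => (w k : E4) :=
      w.orthonormal.comp_linearIsometry S.subtypeₗᵢ
    have h2 := h1.comp (fun i : {i : Fin 4 | i.val < r} => (⟨i.1, i.2⟩ : Fin r)) (by
      rintro ⟨i, hi⟩ ⟨j, hj⟩ h
      ext
      simpa using h)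
    convert h2 using 1
    ext1 ⟨i, hi⟩
    have hi' : i.val < r := hi
    rw [Set.domRestrict_apply]
    exact dif_pos hi'
  obtain ⟨b, hb⟩ := hv.exists_orthonormalBasis_extension_of_card_eq (by simp)
  have hb' : ∀ (i : Fin 4) (h : i.val < r), b i = w ⟨i, h⟩ := by
    intro i h
    rw [hb i h]
    simp [v, h]
  refine ⟨b, fun i hi => ?_, fun i hi x hx => ?_⟩
  · rw [hb' i hi]; exact Submodule.coe_mem _
  · have h4 : r ≤ 4 := by simpa [hr] using Submodule.finrank_le S
    have h1 := congrArg Subtype.val (w.sum_repr ⟨x, hx⟩)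
    rw [show x = ((⟨x, hx⟩ : S) : E4) from rfl, ← h1, AddSubmonoidClass.coe_finsetSum, inner_sum]
    refine Finset.sum_eq_zero fun k _ => ?_
    have h2 : (w k : E4) = b ⟨k.val, by omega⟩ := by rw [hb' _ k.2]
    rw [Submodule.coe_smul, inner_smul_right, h2,
      b.orthonormal.2 fun h => hi (by rw [h]; exact k.2), mul_zero]

/-- In an orthonormal basis whose first `r` vectors span the configuration, the rotations in the
coordinate planes `l < s` with `l < r` act independently on `q`. The others annihilate it. -/
lemma finrank_orbitTangent_eq_card (q : Config n) :
    Module.finrank ℝ (orbitTangent q) = Fintype.card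
      {p : Fin 4 × Fin 4 // p.1 < p.2 ∧ p.1.val < Module.finrank ℝ (configSpan q)} := by
  obtain ⟨b, hb1, hb2⟩ := exists_adapted_basis (configSpan q)
  set r := Module.finrank ℝ (configSpan q)
  let w : {p : Fin 4 × Fin 4 // p.1 < p.2 ∧ p.1.val < r} → Config n :=
    fun p => blockDiag n (wedge (b p.1.1) (b p.1.2)) q
  have hb : ∀ i j, ⟪b i, b j⟫_ℝ = if i = j then 1 else 0 :=
    orthonormal_iff_ite.mp b.orthonormal
  have hli : LinearIndependent ℝ w := by
    rw [Fintype.linearIndependent_iff]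
    intro c hc
    set a : E4 →ₗ[ℝ] E4 := ∑ p, c p • wedge (b p.1.1) (b p.1.2) with ha
    have h1 : ∀ x ∈ configSpan q, a x = 0 := by
      intro x hx
      induction hx using Submodule.span_induction with
      | mem x h =>
        obtain ⟨i, rfl⟩ := h
        have := congrArg (fun y : Config n => y i) hc
        simpa [ha, w, blockDiag_apply, LinearMap.sum_apply, WithLp.ofLp_sum] using this
      | zero => simp
      | add x y _ _ h1 h2 => rw [map_add, h1, h2, add_zero]
      | smul t x _ h => rw [map_smul, h, smul_zero]
    rintro ⟨⟨l, s⟩, hls, hlr⟩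
    -- This matrix entry isolates the coefficient of the pair `(l, s)`; since pairs are ordered, no
    -- other wedge contributes to it.
    have h2 : ⟪a (b l), b s⟫_ℝ = 0 := by rw [h1 _ (hb1 l hlr), inner_zero_left]
    rw [ha, LinearMap.sum_apply, sum_inner] at h2
    rw [Finset.sum_eq_single ⟨⟨l, s⟩, hls, hlr⟩] at h2
    · simpa [wedge, rankOne_apply, hb, inner_sub_left, inner_smul_left, hls.ne, hls.ne'] using h2
    · rintro ⟨⟨l', s'⟩, hls', hlr'⟩ - hne
      simp only [wedge, rankOne_apply, hb, inner_sub_left, inner_smul_left, LinearMap.smul_apply,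
        LinearMap.sub_apply]
      by_cases h3 : l' = l
      · have h4 : s' ≠ s := fun h4 => hne (by simp [h3, h4])
        have h5 : s' ≠ l := fun h5 => hls'.ne (h3.trans h5.symm)
        simp [h4, h5]
      · by_cases h5 : s' = l
        · have h6 : l' ≠ s := fun h6 => by
            have h7 := hls'
            rw [h6, h5] at h7
            exact lt_asymm hls h7
          simp [h3, h6]
        · simp [h3, h5]
    · intro h; exact absurd (Finset.mem_univ _) h
  have hspan : Submodule.span ℝ (Set.range w) = orbitTangent q := by
    refine le_antisymm ?_ fun x hx => ?_
    · rw [Submodule.span_le]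
      rintro _ ⟨p, rfl⟩
      exact mem_orbitTangent_of_skew q (wedge_skew _ _)
    · obtain ⟨a, ha, rfl⟩ := orbitTangent_eq hx
      have hself : ∀ l, ⟪a (b l), b l⟫_ℝ = 0 := fun l => by
        rw [real_inner_comm]; exact ha.inner_self _
      have hflip : ∀ l s, ⟪a (b l), b s⟫_ℝ = -⟪a (b s), b l⟫_ℝ := fun l s => by
        rw [ha, real_inner_comm]
      have key : blockDiag n a q = ∑ p : Fin 4 × Fin 4,
          if p.1 < p.2 then ⟪a (b p.1), b p.2⟫_ℝ • blockDiag n (wedge (b p.1) (b p.2)) q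
          else 0 := by
        ext1 i
        have h1 := b.sum_repr' (q i)
        have h2 : ∀ l, a (b l) = ∑ s, ⟪b s, a (b l)⟫_ℝ • b s := fun l => (b.sum_repr' _).symm
        rw [blockDiag_apply]
        conv_lhs => rw [← h1]
        rw [map_sum]
        simp only [map_smul]
        have h3 : ∀ l, a (b l) = ∑ s, ⟪a (b l), b s⟫_ℝ • b s := fun l => by
          conv_lhs => rw [h2 l]
          exact Finset.sum_congr rfl fun s _ => by rw [real_inner_comm]
        simp only [Fintype.sum_prod_type, Fin.sum_univ_four] at h3 ⊢
        conv_lhs => rw [h3 0, h3 1, h3 2, h3 3]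
        rw [hself 0, hself 1, hself 2, hself 3, hflip 1 0, hflip 2 0, hflip 3 0, hflip 2 1,
          hflip 3 1, hflip 3 2]
        simp [blockDiag_apply, wedge, rankOne_apply]
        module
      rw [key]
      refine Submodule.sum_mem _ fun p _ => ?_
      split_ifs with hp
      · by_cases hpr : p.1.val < r
        · exact Submodule.smul_mem _ _ (Submodule.subset_span ⟨⟨p, hp, hpr⟩, rfl⟩)
        · have h0 : blockDiag n (wedge (b p.1) (b p.2)) q = 0 := by
            ext1 i
            -- Both vectors of the wedge are then orthogonal to the configuration.
            have h2 : ¬ p.2.val < r := fun h => hpr (lt_trans hp h)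
            simp [blockDiag_apply, wedge, rankOne_apply, hb2 _ hpr _ (mem_configSpan q i),
              hb2 _ h2 _ (mem_configSpan q i)]
          rw [h0, smul_zero]
          exact zero_mem _
      · exact zero_mem _
  rw [← hspan, finrank_span_eq_card hli]

/-- With the rank as a separate variable, a numeral can be substituted and the count left to
`decide`: 3, 5, 6, 6 for ranks 1, 2, 3, 4. -/
lemma finrank_orbitTangent {q : Config n} {r : ℕ} (hr : Module.finrank ℝ (configSpan q) = r) :
    Module.finrank ℝ (orbitTangent q) = Fintype.card
      {p : Fin 4 × Fin 4 // p.1 < p.2 ∧ p.1.val < r} := by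
  rw [finrank_orbitTangent_eq_card]
  subst hr
  rfl

lemma finrank_orbitTangent_of_not_planar {q : Config n} (h : ¬ IsPlanar q) :
    Module.finrank ℝ (orbitTangent q) = 6 := by
  have h1 : ¬ Module.finrank ℝ (configSpan q) ≤ 2 := h
  have h2 : Module.finrank ℝ (configSpan q) ≤ 4 := by
    simpa using Submodule.finrank_le (configSpan q)
  obtain h3 | h3 : Module.finrank ℝ (configSpan q) = 3 ∨ Module.finrank ℝ (configSpan q) = 4 := by
    omega
  · rw [finrank_orbitTangent h3]; decide
  · rw [finrank_orbitTangent h3]; decide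

lemma finrank_configSpan_pos {q : Config n} (hq : q ≠ 0) :
    0 < Module.finrank ℝ (configSpan q) := by
  rw [Nat.pos_iff_ne_zero]
  intro h
  rw [Submodule.finrank_eq_zero] at h
  refine hq ?_
  ext1 i
  have := mem_configSpan q i
  rw [h] at this
  simpa using this

lemma finrank_orbitTangent_of_collinear {q : Config n} (hq : q ≠ 0) (h : IsCollinear q) :
    Module.finrank ℝ (orbitTangent q) = 3 := by
  have h1 : Module.finrank ℝ (configSpan q) ≤ 1 := h
  have h2 := finrank_configSpan_pos hq
  rw [finrank_orbitTangent (show Module.finrank ℝ (configSpan q) = 1 by omega)]; decide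

lemma finrank_orbitTangent_of_planar {q : Config n} (h : IsPlanar q) (h' : ¬ IsCollinear q) :
    Module.finrank ℝ (orbitTangent q) = 5 := by
  have h1 : Module.finrank ℝ (configSpan q) ≤ 2 := h
  have h2 : ¬ Module.finrank ℝ (configSpan q) ≤ 1 := h'
  rw [finrank_orbitTangent (show Module.finrank ℝ (configSpan q) = 2 by omega)]; decide

end Skew

/-! ### Reduction of Hessian and linearization to the complement of the symmetries. -/

section Reduction

/-- The configurations split off: translations and rotation directions. -/
def splitOff (m : Fin n → ℝ) (q : Config n) : Submodule ℝ (Config n) :=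
  translations n ⊔ rotationDirections m q

/-- The complement of `splitOff` that is orthogonal for the mass scalar product. -/
def reduced (m : Fin n → ℝ) (q : Config n) : Submodule ℝ (Config n) :=
  ((splitOff m q).map (massMatrix m))ᗮ

lemma mem_reduced {m : Fin n → ℝ} {q x : Config n} :
    x ∈ reduced m q ↔ ∀ w ∈ splitOff m q, ⟪massMatrix m w, x⟫_ℝ = 0 := by
  rw [reduced, Submodule.mem_orthogonal]
  exact ⟨fun h w hw => h _ (Submodule.mem_map_of_mem hw), by rintro h _ ⟨w, hw, rfl⟩; exact h w hw⟩

lemma disjoint_splitOff_reduced {m : Fin n → ℝ} (hm : ∀ i, 0 < m i) (q : Config n) :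
    Disjoint (splitOff m q) (reduced m q) := by
  rw [Submodule.disjoint_def]
  intro x h1 h2
  exact eq_zero_of_inner_massMatrix_self hm (mem_reduced.mp h2 x h1)

lemma finrank_config : Module.finrank ℝ (Config n) = 4 * n := by
  rw [(WithLp.linearEquiv 2 ℝ (Fin n → E4)).finrank_eq, Module.finrank_pi_fintype]
  simp [mul_comm]

lemma finrank_splitOff_add_reduced {m : Fin n → ℝ} (hm : ∀ i, 0 < m i) (q : Config n) :
    Module.finrank ℝ (splitOff m q) + Module.finrank ℝ (reduced m q) = 4 * n := by
  have h := Submodule.finrank_add_finrank_orthogonal ((splitOff m q).map (massMatrix m))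
  rwa [finrank_config, ← (mapEquivOfInj (massMatrix m) fun x _ h =>
    massMatrix_injective hm (h.trans (map_zero _).symm)).finrank_eq] at h

lemma splitOff_sup_reduced {m : Fin n → ℝ} (hm : ∀ i, 0 < m i) (q : Config n) :
    splitOff m q ⊔ reduced m q = ⊤ := by
  refine Submodule.eq_top_of_finrank_eq ?_
  rw [finrank_sup_of_disjoint (disjoint_splitOff_reduced hm q), finrank_splitOff_add_reduced hm,
    finrank_config]

lemma mem_translations (v : E4) : (WithLp.toLp 2 fun _ => v : Config n) ∈ translations n :=
  Submodule.subset_span ⟨v, rfl⟩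

lemma finrank_translations (hn : 0 < n) : Module.finrank ℝ (translations n) = 4 := by
  let f : E4 →ₗ[ℝ] Config n :=
    { toFun := fun v => WithLp.toLp 2 fun _ => v
      map_add' := fun _ _ => rfl
      map_smul' := fun _ _ => rfl }
  have hf : Function.Injective f := fun v w h =>
    congrArg (fun y : Config n => y ⟨0, hn⟩) h
  have h : translations n = LinearMap.range f := by
    refine le_antisymm ?_ ?_
    · intro x hx
      obtain ⟨v, rfl⟩ := translations_eq hx
      exact ⟨v, rfl⟩
    · rintro _ ⟨v, rfl⟩
      exact mem_translations v
  rw [h, LinearMap.finrank_range_of_inj hf]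
  simp

/-- A space of infinitesimal rotations which together with `q` spans `rotationDirections`. -/
structure IsRotationComplement (m : Fin n → ℝ) (q : Config n) (Z : Submodule ℝ (Config n)) :
    Prop where
  span_sup : rotationDirections m q = Submodule.span ℝ {q} ⊔ Z
  le_orbitTangent : Z ≤ orbitTangent q
  finrank_add_one : Module.finrank ℝ Z + 1 = blockSize m q

lemma sum_smul_orbitTangent {m : Fin n → ℝ} {q : Config n} (hq : IsCentralConfiguration m q)
    {z : Config n} (hz : z ∈ orbitTangent q) : ∑ i, m i • z i = 0 := by
  obtain ⟨a, -, rfl⟩ := orbitTangent_eq hz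
  simp only [blockDiag_apply, ← map_smul, ← map_sum, hq.centered, map_zero]

lemma inner_massMatrix_orbitTangent (m : Fin n → ℝ) {q z : Config n} (hz : z ∈ orbitTangent q) :
    ⟪massMatrix m q, z⟫_ℝ = 0 := by
  obtain ⟨a, ha, rfl⟩ := orbitTangent_eq hz
  rw [inner_config]
  refine Finset.sum_eq_zero fun i _ => ?_
  rw [blockDiag_apply]
  simp [scaleBodies, inner_smul_left, ha.inner_self]

lemma hessU_orbitTangent {m : Fin n → ℝ} {q : Config n} (hq : IsCentralConfiguration m q)
    {z : Config n} (hz : z ∈ orbitTangent q) :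
    hessU m q z = (-potential m q) • massMatrix m z := by
  obtain ⟨a, ha, rfl⟩ := orbitTangent_eq hz
  exact hessU_skew hq ha

variable {m : Fin n → ℝ} {q : Config n} {Z : Submodule ℝ (Config n)}

lemma IsRotationComplement.finrank_rotationDirections (hZ : IsRotationComplement m q Z)
    (hq : IsCentralConfiguration m q) :
    Module.finrank ℝ (rotationDirections m q) = blockSize m q := by
  have hd : Disjoint (Submodule.span ℝ {q}) Z := by
    rw [Submodule.disjoint_def]
    intro x hx hxZ
    obtain ⟨c, rfl⟩ := Submodule.mem_span_singleton.mp hx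
    have h := inner_massMatrix_orbitTangent m (hZ.le_orbitTangent hxZ)
    rw [inner_smul_right, hq.normalized, mul_one] at h
    rw [h, zero_smul]
  rw [hZ.span_sup, finrank_sup_of_disjoint hd, finrank_span_singleton hq.ne_zero, add_comm,
    hZ.finrank_add_one]

lemma IsRotationComplement.finrank_reduced (hZ : IsRotationComplement m q Z) (hn : 3 ≤ n)
    (hm : ∀ i, 0 < m i) (hq : IsCentralConfiguration m q) :
    4 + blockSize m q + Module.finrank ℝ (reduced m q) = 4 * n := by
  have hd : Disjoint (translations n) (rotationDirections m q) := by
    rw [Submodule.disjoint_def]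
    intro x hx hxR
    obtain ⟨v, rfl⟩ := translations_eq hx
    rw [hZ.span_sup] at hxR
    obtain ⟨y, hy, z, hz, hyz⟩ := Submodule.mem_sup.mp hxR
    obtain ⟨c, rfl⟩ := Submodule.mem_span_singleton.mp hy
    refine eq_zero_of_inner_massMatrix_self hm ?_
    rw [inner_massMatrix_translation, ← hyz]
    have h1 : ∑ i, m i • (c • q + z) i = c • ∑ i, m i • q i + ∑ i, m i • z i := by
      rw [Finset.smul_sum, ← Finset.sum_add_distrib]
      refine Finset.sum_congr rfl fun i _ => ?_
      rw [PiLp.add_apply, PiLp.smul_apply, smul_add, smul_comm]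
    rw [h1, hq.centered, sum_smul_orbitTangent hq (hZ.le_orbitTangent hz)]
    simp
  rw [← finrank_splitOff_add_reduced hm q, splitOff, finrank_sup_of_disjoint hd,
    finrank_translations (by omega), hZ.finrank_rotationDirections hq]

lemma reduced_le_tangentEllipsoid (hq : q ∈ rotationDirections m q) :
    reduced m q ≤ tangentEllipsoid m q := by
  intro x hx
  rw [mem_reduced] at hx
  refine ⟨ext_inner_left ℝ fun v => ?_, hx q (Submodule.mem_sup_right hq)⟩
  rw [← inner_massMatrix_translation, hx _ (Submodule.mem_sup_left (mem_translations v)),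
    inner_zero_right]

lemma IsRotationComplement.self_mem (hZ : IsRotationComplement m q Z) :
    q ∈ rotationDirections m q := by
  rw [hZ.span_sup]
  exact Submodule.mem_sup_left (Submodule.mem_span_singleton_self q)

lemma IsRotationComplement.le_splitOff (hZ : IsRotationComplement m q Z) :
    Z ≤ splitOff m q := by
  rw [splitOff, hZ.span_sup]
  exact le_sup_of_le_right le_sup_right

/-- All of `splitOff` except the translations and `q` itself is tangent to the ellipsoid, while
translations and `q` are the mass-normals of the tangent space. -/
lemma IsRotationComplement.sup_reduced (hZ : IsRotationComplement m q Z) (hm : ∀ i, 0 < m i)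
    (hq : IsCentralConfiguration m q) : Z ⊔ reduced m q = tangentEllipsoid m q := by
  have hZT : Z ≤ tangentEllipsoid m q := fun z hz =>
    ⟨sum_smul_orbitTangent hq (hZ.le_orbitTangent hz),
      inner_massMatrix_orbitTangent m (hZ.le_orbitTangent hz)⟩
  have hNT := reduced_le_tangentEllipsoid hZ.self_mem
  refine le_antisymm (sup_le hZT hNT) fun x hx => ?_
  obtain ⟨w, hw, y, hy, rfl⟩ := Submodule.mem_sup.mp
    (splitOff_sup_reduced hm q ▸ Submodule.mem_top : x ∈ splitOff m q ⊔ reduced m q)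
  rw [splitOff, hZ.span_sup] at hw
  obtain ⟨t, ht, s, hs, rfl⟩ := Submodule.mem_sup.mp hw
  obtain ⟨c, hc, z, hz, rfl⟩ := Submodule.mem_sup.mp hs
  have h1 : t + c ∈ tangentEllipsoid m q := by
    have : t + c = t + (c + z) + y - y - z := by abel
    rw [this]
    exact sub_mem (sub_mem hx (hNT hy)) (hZT hz)
  obtain ⟨v, rfl⟩ := translations_eq ht
  obtain ⟨d, rfl⟩ := Submodule.mem_span_singleton.mp hc
  -- A tangent vector made of a translation and a multiple of `q` is mass-orthogonal to itself.
  have h2 : (WithLp.toLp 2 fun _ => v) + d • q = 0 := by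
    refine eq_zero_of_inner_massMatrix_self hm ?_
    nth_rw 1 [map_add]
    rw [inner_add_left, inner_massMatrix_translation, h1.1, map_smul, inner_smul_left, h1.2]
    simp
  have h3 : (WithLp.toLp 2 fun _ => v) + (d • q + z) + y = z + y := by
    rw [← add_assoc, h2, zero_add]
  rw [h3]
  exact Submodule.add_mem_sup hz hy

/-- The quadratic form of `D²U(q) + U(q) M`. -/
def hessForm (m : Fin n → ℝ) (q : Config n) : QuadraticForm ℝ (Config n) :=
  quadForm (hessU m q + potential m q • massMatrix m)

lemma quadForm_apply (A : Config n →ₗ[ℝ] Config n) (x : Config n) :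
    quadForm A x = ⟪A x, x⟫_ℝ := rfl

lemma hessForm_apply (m : Fin n → ℝ) (q x : Config n) :
    hessForm m q x = ⟪hessU m q x, x⟫_ℝ + potential m q * ⟪massMatrix m x, x⟫_ℝ := by
  rw [hessForm, quadForm_apply, LinearMap.add_apply, inner_add_left, LinearMap.smul_apply,
    inner_smul_left]
  rfl

lemma hessForm_add {x y : Config n} (hq : IsCentralConfiguration m q)
    (h : ⟪hessU m q x, y⟫_ℝ = 0) (h' : ⟪massMatrix m x, y⟫_ℝ = 0) :
    hessForm m q (x + y) = hessForm m q x + hessForm m q y := by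
  have h1 : ⟪hessU m q y, x⟫_ℝ = 0 := by
    rw [hessU_symm m hq.collisionFree, real_inner_comm, h]
  have h2 : ⟪massMatrix m y, x⟫_ℝ = 0 := by rw [inner_massMatrix, real_inner_comm, h']
  simp only [hessForm_apply, map_add, inner_add_left, inner_add_right, h, h', h1, h2]
  ring

/-- On infinitesimal rotations `D²U = -U M`, so `Z` lies in the radical of the Hessian. It
contributes nothing to the index and `k - 1` to the nullity. -/
lemma IsRotationComplement.index_nullity (hZ : IsRotationComplement m q Z) (hm : ∀ i, 0 < m i)
    (hq : IsCentralConfiguration m q) :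
    morseIndex m q = sigNeg ((hessForm m q).restrict (reduced m q)) ∧
    nullity m q + 1 = blockSize m q +
      Module.finrank ℝ ((hessForm m q).restrict (reduced m q)).radical := by
  have hd := (disjoint_splitOff_reduced hm q).mono_left hZ.le_splitOff
  have hZ0 : ∀ z ∈ Z, hessForm m q z = 0 := by
    intro z hz
    rw [hessForm_apply, hessU_orbitTangent hq (hZ.le_orbitTangent hz), inner_smul_left]
    simp
  have h := sig_sup (hessForm m q) hd fun z hz y hy => by
    have h2 := mem_reduced.mp hy z (hZ.le_splitOff hz)
    refine hessForm_add hq ?_ h2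
    rw [hessU_orbitTangent hq (hZ.le_orbitTangent hz), inner_smul_left, h2, mul_zero]
  have h0 := sig_of_zero _ hZ0
  have hf := hZ.finrank_add_one
  rw [hZ.sup_reduced hm hq] at h
  have e1 : morseIndex m q = sigNeg ((hessForm m q).restrict (tangentEllipsoid m q)) := rfl
  have e2 : nullity m q =
    Module.finrank ℝ ((hessForm m q).restrict (tangentEllipsoid m q)).radical := rfl
  omega

/-- The quadratic form `-⟨D²U x, x⟩ - ⟨M K x, K x⟩` of the effective potential. -/
def effForm (m : Fin n → ℝ) (q : Config n) : QuadraticForm ℝ (Config n) :=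
  quadForm (-hessU m q + frameK m q ∘ₗ massMatrix m ∘ₗ frameK m q)

lemma effForm_apply (m : Fin n → ℝ) (q x : Config n) : effForm m q x =
    -⟪hessU m q x, x⟫_ℝ - ⟪massMatrix m (frameK m q x), frameK m q x⟫_ℝ := by
  rw [effForm, quadForm_apply, LinearMap.add_apply, inner_add_left, LinearMap.neg_apply,
    inner_neg_left, LinearMap.comp_apply, LinearMap.comp_apply, inner_frameK]
  ring

lemma effForm_add {x y : Config n} (hq : IsCentralConfiguration m q)
    (h : ⟪hessU m q x, y⟫_ℝ = 0)
    (h' : ⟪massMatrix m (frameK m q x), frameK m q y⟫_ℝ = 0) :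
    effForm m q (x + y) = effForm m q x + effForm m q y := by
  have h1 : ⟪hessU m q y, x⟫_ℝ = 0 := by
    rw [hessU_symm m hq.collisionFree, real_inner_comm, h]
  have h2 : ⟪massMatrix m (frameK m q y), frameK m q x⟫_ℝ = 0 := by
    rw [inner_massMatrix, real_inner_comm, h']
  simp only [effForm_apply, map_add, inner_add_left, inner_add_right, h, h', h1, h2]
  ring

/-- The sum of `E₁` and `E₂` is `W × MW` with `W = splitOff`. Pairing with `(0, M w)` tests the
position and pairing with `(w, 0)` tests the momentum. -/
lemma mem_E₃ {z : Phase n} (hm : ∀ i, 0 < m i) :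
    z ∈ E₃ m q ↔ z.1 ∈ reduced m q ∧ massMatrixInv m z.2 ∈ reduced m q := by
  rw [E₃, LinearMap.BilinForm.mem_orthogonal_iff, mem_reduced, mem_reduced]
  have h0 : ∀ w, ⟪massMatrix m w, massMatrixInv m z.2⟫_ℝ = ⟪w, z.2⟫_ℝ := fun w => by
    rw [inner_massMatrix, massMatrix_massMatrixInv hm]
  constructor
  · intro h
    have key : ∀ w ∈ splitOff m q, ((w, 0) : Phase n) ∈ E₁ m ⊔ E₂ m q ∧
        ((0, massMatrix m w) : Phase n) ∈ E₁ m ⊔ E₂ m q := by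
      intro w hw
      obtain ⟨t, ht, v, hv, rfl⟩ := Submodule.mem_sup.mp hw
      constructor
      · have : ((t + v, 0) : Phase n) = (t, 0) + (v, 0) := by simp
        rw [this]
        exact Submodule.add_mem_sup ⟨ht, zero_mem _⟩ ⟨hv, zero_mem _⟩
      · have : ((0, massMatrix m (t + v)) : Phase n) = (0, massMatrix m t) + (0, massMatrix m v) := by
          simp
        rw [this]
        exact Submodule.add_mem_sup ⟨zero_mem _, Submodule.mem_map_of_mem ht⟩
          ⟨zero_mem _, Submodule.mem_map_of_mem hv⟩
    refine ⟨fun w hw => ?_, fun w hw => ?_⟩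
    · have h1 : sympForm n (0, massMatrix m w) z = 0 := h _ (key w hw).2
      rw [sympForm_apply, inner_zero_left, add_zero, neg_eq_zero] at h1
      exact h1
    · have h1 : sympForm n (w, 0) z = 0 := h _ (key w hw).1
      rw [sympForm_apply, inner_zero_left, neg_zero, zero_add] at h1
      rw [h0]
      exact h1
  · rintro ⟨h1, h2⟩ w hw
    change sympForm n w z = 0
    rw [sympForm_apply]
    obtain ⟨⟨a, _⟩, ⟨ha, a', ha', rfl⟩, ⟨b, _⟩, ⟨hb, b', hb', rfl⟩, rfl⟩ := Submodule.mem_sup.mp hw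
    have e1 := h1 _ (add_mem (Submodule.mem_sup_left ha') (Submodule.mem_sup_right hb') :
      a' + b' ∈ splitOff m q)
    have e2 := h2 _ (add_mem (Submodule.mem_sup_left ha) (Submodule.mem_sup_right hb) :
      a + b ∈ splitOff m q)
    rw [h0] at e2
    rw [map_add] at e1
    simp only [Prod.mk_add_mk]
    rw [e1, e2]
    simp

/-- `K` preserves `splitOff`, is skew and commutes with `M`, so it preserves the mass-orthogonal
complement. -/
lemma frameK_mem_reduced {x : Config n} (hx : x ∈ reduced m q) : frameK m q x ∈ reduced m q := by
  rw [mem_reduced] at hx ⊢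
  intro w hw
  have h1 : frameK m q w ∈ splitOff m q := by
    obtain ⟨t, ht, v, hv, rfl⟩ := Submodule.mem_sup.mp hw
    rw [map_add]
    exact Submodule.add_mem_sup (frameK_translations m q ht) (frameK_rotationDirections m q hv)
  have h2 : massMatrix m (frameK m q w) = frameK m q (massMatrix m w) :=
    massMatrix_blockDiag m _ w
  rw [← neg_eq_zero, ← inner_frameK, ← h2, hx _ h1]

/-- The quadratic form of `B`. -/
def formB (m : Fin n → ℝ) (q : Config n) : QuadraticForm ℝ (Phase n) :=
  LinearMap.BilinMap.toQuadraticMap ((phaseInner n).comp (matB m q) LinearMap.id)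

lemma formB_eq_sympForm (m : Fin n → ℝ) (q : Config n) (z : Phase n) :
    formB m q z = -sympForm n (matJB m q z) z := by
  have h : formB m q z = phaseInner n (matB m q z) z := rfl
  have h2 : sympForm n (matJB m q z) z = phaseInner n (stdJ n (stdJ n (matB m q z))) z := rfl
  rw [h, h2]
  have h3 : ∀ w, stdJ n (stdJ n w) = -w := fun w => by ext1 <;> simp [stdJ]
  rw [h3, map_neg, LinearMap.neg_apply, neg_neg]

/-- Completion of the square in the momentum `p = M y`; the cross term is `2⟨M y, K x⟩`. -/
lemma formB_apply (hm : ∀ i, 0 < m i) (x y : Config n) :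
    formB m q (x, massMatrix m y) = effForm m q x +
      ⟪massMatrix m (y + frameK m q x), y + frameK m q x⟫_ℝ := by
  rw [formB_eq_sympForm, matJB_apply, sympForm_apply, effForm_apply, massMatrixInv_massMatrix hm]
  have h2 : frameK m q (massMatrix m y) = massMatrix m (frameK m q y) :=
    (massMatrix_blockDiag m _ y).symm
  have h3 : ⟪massMatrix m (frameK m q y), x⟫_ℝ = -⟪massMatrix m y, frameK m q x⟫_ℝ := by
    rw [← h2, inner_frameK]
  have h4 : ⟪massMatrix m (frameK m q x), y⟫_ℝ = ⟪massMatrix m y, frameK m q x⟫_ℝ := by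
    rw [inner_massMatrix, real_inner_comm]
  have h5 : ⟪frameK m q x, massMatrix m y⟫_ℝ = ⟪massMatrix m y, frameK m q x⟫_ℝ :=
    real_inner_comm _ _
  have h6 : ⟪y, massMatrix m y⟫_ℝ = ⟪massMatrix m y, y⟫_ℝ := real_inner_comm _ _
  simp only [map_add, inner_add_left, inner_add_right, inner_neg_left, inner_sub_left, h2, h3, h4,
    h5, h6]
  ring

/-- Index and nullity of `B₃` are those of the effective potential on the reduced space. -/
lemma index_formB₃ (hm : ∀ i, 0 < m i) (q : Config n) :
    sigNeg (formB₃ m q) = sigNeg ((effForm m q).restrict (reduced m q)) ∧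
    Module.finrank ℝ (formB₃ m q).radical =
      Module.finrank ℝ ((effForm m q).restrict (reduced m q)).radical ∧
    Module.finrank ℝ (E₃ m q) = 2 * Module.finrank ℝ (reduced m q) := by
  -- The graph of `-MK` is where the completed square vanishes, so `B` restricts to the effective
  -- form there. Its complement, the momentum space, carries a positive definite form.
  let f : Config n →ₗ[ℝ] Phase n := LinearMap.id.prod (-(massMatrix m ∘ₗ frameK m q))
  let g : Config n →ₗ[ℝ] Phase n := LinearMap.prod 0 (massMatrix m)
  have hf : ∀ x, f x = (x, massMatrix m (-frameK m q x)) := fun x => by simp [f]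
  have hg : ∀ x, g x = (0, massMatrix m x) := fun x => rfl
  have hf0 : ∀ x ∈ reduced m q, f x = 0 → x = 0 := fun x _ h => congrArg Prod.fst h
  have hg0 : ∀ x ∈ reduced m q, g x = 0 → x = 0 := fun x _ h =>
    massMatrix_injective hm ((congrArg Prod.snd h).trans (map_zero _).symm)
  have hsup : (reduced m q).map f ⊔ (reduced m q).map g = E₃ m q := by
    refine le_antisymm (sup_le ?_ ?_) fun z hz => ?_
    · rintro _ ⟨x, hx, rfl⟩
      rw [mem_E₃ hm, hf, massMatrixInv_massMatrix hm]
      exact ⟨hx, neg_mem (frameK_mem_reduced hx)⟩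
    · rintro _ ⟨x, hx, rfl⟩
      rw [mem_E₃ hm, hg, massMatrixInv_massMatrix hm]
      exact ⟨zero_mem _, hx⟩
    · rw [mem_E₃ hm] at hz
      have : z = f z.1 + g (massMatrixInv m z.2 + frameK m q z.1) := by
        rw [hf, hg, Prod.mk_add_mk, ← map_add, add_zero]
        ext1
        · rfl
        · simp [massMatrix_massMatrixInv hm]
      rw [this]
      exact Submodule.add_mem_sup (Submodule.mem_map_of_mem hz.1)
        (Submodule.mem_map_of_mem (add_mem hz.2 (frameK_mem_reduced hz.1)))
  have hd : Disjoint ((reduced m q).map f) ((reduced m q).map g) := by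
    rw [Submodule.disjoint_def]
    rintro _ ⟨x, hx, rfl⟩ ⟨y, hy, h⟩
    have : x = 0 := (congrArg Prod.fst h).symm
    rw [this, map_zero]
  have hadd := sig_sup (formB m q) hd (by
    rintro _ ⟨x, hx, rfl⟩ _ ⟨y, hy, rfl⟩
    rw [hf, hg, Prod.mk_add_mk, add_zero, ← map_add, formB_apply hm, formB_apply hm,
      formB_apply hm]
    have h1 : -frameK m q x + y + frameK m q x = y := by abel
    rw [h1]
    simp [effForm_apply])
  have hpos := sig_of_pos (formB m q) (S := (reduced m q).map g) (by
    rintro _ ⟨y, hy, rfl⟩ h0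
    rw [hg, formB_apply hm]
    have hy0 : y ≠ 0 := fun h => h0 (by rw [h, map_zero])
    simpa [effForm_apply] using inner_massMatrix_self_pos hm hy0)
  have heq := restrict_equivalent (effForm m q) (formB m q) f hf0 (by
    intro x _
    rw [hf, formB_apply hm]
    simp)
  have h1 := heq.sigNeg_eq
  have h2 := heq.rank_radical_eq
  have h3 := finrank_sup_of_disjoint hd
  rw [← (mapEquivOfInj f hf0).finrank_eq, ← (mapEquivOfInj g hg0).finrank_eq] at h3
  rw [hsup] at hadd h3
  have e1 : formB₃ m q = (formB m q).restrict (E₃ m q) := rfl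
  rw [e1]
  omega

end Reduction

/-! ### The generator `κ𝐢`, the choice of rotation complement, and orbit parity. -/

section NonPlanar

variable {m : Fin n → ℝ} {q : Config n}

lemma norm_quatI (x : E4) : ‖act quatI x‖ ^ 2 = ‖x‖ ^ 2 := by
  rw [← real_inner_self_eq_norm_sq, ← real_inner_self_eq_norm_sq, quatI_skew, act_quatI_quatI,
    inner_neg_right, neg_neg]

/-- Since `𝐢` is an isometry and `κ² = U`, the centrifugal term is exactly `U ⟨Mx, x⟩`. The
hypothesis is on the single vector `x`, so that the lemma also serves for vectors in the plane of
motion of a planar equilibrium. -/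
lemma effForm_eq_neg_hessForm (hn : 3 ≤ n) (hm : ∀ i, 0 < m i) (hq : IsCentralConfiguration m q)
    {x : Config n} (hx : frameK m q x = angularSpeed m q • blockDiag n (act quatI) x) :
    effForm m q x = -hessForm m q x := by
  rw [effForm_apply, hessForm_apply, hx, map_smul, inner_smul_left, inner_smul_right,
    inner_massMatrix_self, inner_massMatrix_self]
  simp only [blockDiag_apply, norm_quatI, conj_trivial]
  rw [← mul_assoc, angularSpeed_sq hn hm hq]
  ring

lemma frameK_of_not_planar (hp : ¬ IsPlanarRE m q) (x : Config n) :
    frameK m q x = angularSpeed m q • blockDiag n (act quatI) x := by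
  have hG : frameGenerator m q = angularSpeed m q • act quatI := by
    unfold frameGenerator; rw [if_neg hp]
  ext1 i
  simp [frameK, hG, blockDiag]

lemma quaternion_sq (a b c : ℝ) : (a • quatI + b • quatJ + c • quatK) *
    (a • quatI + b • quatJ + c • quatK) = -(a ^ 2 + b ^ 2 + c ^ 2) • 1 := by
  ext i j
  fin_cases i <;> fin_cases j <;>
    simp [quatI, quatJ, quatK, Matrix.mul_apply, Fin.sum_univ_four] <;> ring

/-- A purely imaginary quaternion squares to minus its squared norm, so a nonzero one annihilates no
nonzero vector. -/
lemma finrank_span_quaternion {q : Config n} (hq : q ≠ 0) :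
    Module.finrank ℝ (Submodule.span ℝ {blockDiag n (act quatI) q, blockDiag n (act quatJ) q,
      blockDiag n (act quatK) q}) = 3 := by
  have hli : LinearIndependent ℝ ![blockDiag n (act quatI) q, blockDiag n (act quatJ) q,
      blockDiag n (act quatK) q] := by
    rw [Fintype.linearIndependent_iff]
    intro c hc
    simp only [Fin.sum_univ_three, Matrix.cons_val_zero, Matrix.cons_val_one,
      Matrix.cons_val_two] at hc
    have h1 : ∀ i, act (c 0 • quatI + c 1 • quatJ + c 2 • quatK) (q i) = 0 := by
      intro i
      have := congrArg (fun y : Config n => y i) hc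
      simpa [blockDiag_apply, act] using this
    have h2 : ∀ i, (c 0 ^ 2 + c 1 ^ 2 + c 2 ^ 2) • q i = 0 := by
      intro i
      have h3 := act_mul (c 0 • quatI + c 1 • quatJ + c 2 • quatK)
        (c 0 • quatI + c 1 • quatJ + c 2 • quatK) (q i)
      rw [h1, map_zero, quaternion_sq, act, map_smul, LinearMap.smul_apply, neg_smul,
        neg_eq_zero] at h3
      simpa using h3
    obtain ⟨i, hi⟩ : ∃ i, q i ≠ 0 := by
      by_contra! h
      exact hq (by ext1 i; exact h i)
    have h4 := (smul_eq_zero.mp (h2 i)).resolve_right hi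
    have e0 : c 0 = 0 := by nlinarith [sq_nonneg (c 0), sq_nonneg (c 1), sq_nonneg (c 2)]
    have e1 : c 1 = 0 := by nlinarith [sq_nonneg (c 0), sq_nonneg (c 1), sq_nonneg (c 2)]
    have e2 : c 2 = 0 := by nlinarith [sq_nonneg (c 0), sq_nonneg (c 1), sq_nonneg (c 2)]
    intro k
    fin_cases k
    · exact e0
    · exact e1
    · exact e2
  have h := finrank_span_eq_card hli
  have hr : Set.range ![blockDiag n (act quatI) q, blockDiag n (act quatJ) q,
      blockDiag n (act quatK) q] = {blockDiag n (act quatI) q, blockDiag n (act quatJ) q,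
      blockDiag n (act quatK) q} := by
    ext x
    simp only [Matrix.range_cons, Matrix.range_empty, Set.union_empty, Set.mem_union,
      Set.mem_singleton_iff, Set.mem_insert_iff]
  rw [hr] at h
  rw [h]
  rfl

lemma configSpan_le_motionSpan (m : Fin n → ℝ) (q : Config n) : configSpan q ≤ motionSpan m q := by
  rw [Submodule.span_le]
  rintro _ ⟨i, rfl⟩
  exact mem_motionSpan m q i

lemma isPlanar_of_isPlanarRE (hp : IsPlanarRE m q) : IsPlanar q :=
  (Submodule.finrank_mono (configSpan_le_motionSpan m q)).trans hp

lemma rotationDirections_of_planar (hp : IsPlanarRE m q) :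
    rotationDirections m q = Submodule.span ℝ {q} ⊔ orbitTangent q := by
  unfold rotationDirections; rw [if_pos hp]

/-- The whole orbit tangent space serves for a planar equilibrium, of dimension 3 or 5. For a
non-planar one the three quaternion directions serve, also when `q` itself is planar. -/
lemma exists_isRotationComplement (hq : IsCentralConfiguration m q) :
    ∃ Z, IsRotationComplement m q Z := by
  by_cases hp : IsPlanarRE m q
  · refine ⟨orbitTangent q, rotationDirections_of_planar hp, le_rfl, ?_⟩
    by_cases hc : IsCollinear q
    · rw [finrank_orbitTangent_of_collinear hq.ne_zero hc, blockSize, if_neg fun h => h.2 hc]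
    · rw [finrank_orbitTangent_of_planar (isPlanar_of_isPlanarRE hp) hc, blockSize,
        if_pos ⟨hp, hc⟩]
  · refine ⟨Submodule.span ℝ {blockDiag n (act quatI) q, blockDiag n (act quatJ) q,
      blockDiag n (act quatK) q}, ?_, ?_, ?_⟩
    · unfold rotationDirections
      rw [if_neg hp, Submodule.span_insert]
    · rw [Submodule.span_le]
      rintro x (rfl | rfl | rfl)
      · exact mem_orbitTangent_of_skew q quatI_skew
      · exact mem_orbitTangent_of_skew q quatJ_skew
      · exact mem_orbitTangent_of_skew q quatK_skew
    · rw [finrank_span_quaternion hq.ne_zero, blockSize, if_neg fun h => hp h.1]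

/-- The dimension of the orbit is even exactly for non-planar configurations. -/
lemma even_finrank_orbitTangent_iff (hq : IsCentralConfiguration m q) :
    Even (Module.finrank ℝ (orbitTangent q)) ↔ ¬ IsPlanar q := by
  by_cases hp : IsPlanar q
  · by_cases hc : IsCollinear q
    · rw [finrank_orbitTangent_of_collinear hq.ne_zero hc]
      exact iff_of_false (by decide) (not_not.mpr hp)
    · rw [finrank_orbitTangent_of_planar hp hc]
      exact iff_of_false (by decide) (not_not.mpr hp)
  · rw [finrank_orbitTangent_of_not_planar hp]
    exact iff_of_true (by decide) hp

lemma blockSize_even (m : Fin n → ℝ) (q : Config n) : Even (blockSize m q) := by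
  unfold blockSize
  split_ifs <;> decide

end NonPlanar

/-! ### Planar equilibria: splitting into the plane of motion and two normal lines. -/

section Planar

variable {m : Fin n → ℝ} {q : Config n}

lemma exists_normal_frame {W : Submodule ℝ E4} (hW : Module.finrank ℝ W = 2) :
    ∃ f g : E4, f ∈ Wᗮ ∧ g ∈ Wᗮ ∧ ⟪f, f⟫_ℝ = 1 ∧ ⟪g, g⟫_ℝ = 1 ∧ ⟪f, g⟫_ℝ = 0 ∧
      ∀ x, x = W.starProjection x + (⟪f, x⟫_ℝ • f + ⟪g, x⟫_ℝ • g) := by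
  have hd : Module.finrank ℝ Wᗮ = 2 := by
    have := Submodule.finrank_add_finrank_orthogonal W
    rw [hW, finrank_euclideanSpace_fin] at this
    omega
  let b : OrthonormalBasis (Fin 2) ℝ Wᗮ := (stdOrthonormalBasis ℝ Wᗮ).reindex (finCongr hd)
  have hb : ∀ i j, ⟪(b i : E4), b j⟫_ℝ = if i = j then 1 else 0 :=
    orthonormal_iff_ite.mp b.orthonormal
  refine ⟨b 0, b 1, (b 0).2, (b 1).2, by rw [hb, if_pos rfl], by rw [hb, if_pos rfl],
    by rw [hb, if_neg (by decide)], fun x => ?_⟩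
  have h1 : x - W.starProjection x ∈ Wᗮ := W.sub_starProjection_mem_orthogonal x
  have h2 := congrArg Subtype.val (b.sum_repr' ⟨_, h1⟩)
  rw [Fin.sum_univ_two] at h2
  have h3 : ∀ i, ⟪b i, (⟨x - W.starProjection x, h1⟩ : Wᗮ)⟫_ℝ = ⟪(b i : E4), x⟫_ℝ := by
    intro i
    have h4 : ⟪(b i : E4), W.starProjection x⟫_ℝ = 0 := by
      rw [real_inner_comm]
      exact (b i).2 _ (W.starProjection_apply_mem x)
    change ⟪(b i : E4), x - W.starProjection x⟫_ℝ = _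
    rw [inner_sub_right, h4, sub_zero]
  rw [h3, h3] at h2
  exact (add_eq_of_eq_sub' h2).symm

/-- The plane of motion contains `qᵢ` and `𝐢qᵢ`, which are independent when `qᵢ ≠ 0`. So there are
exactly two normal directions, the source of the even contributions below. -/
lemma finrank_motionSpan (hp : IsPlanarRE m q) (hk : angularSpeed m q ≠ 0) (hq : q ≠ 0) :
    Module.finrank ℝ (motionSpan m q) = 2 := by
  refine le_antisymm hp ?_
  obtain ⟨i, hi⟩ : ∃ i, q i ≠ 0 := by
    by_contra! h
    exact hq (by ext1 i; exact h i)
  have hli : LinearIndependent ℝ ![q i, act quatI (q i)] := by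
    rw [LinearIndependent.pair_iff]
    intro s t hst
    have h5 := quatI_skew.inner_self (q i)
    have h1 : ⟪q i, s • q i + t • act quatI (q i)⟫_ℝ = 0 := by rw [hst, inner_zero_right]
    rw [inner_add_right, inner_smul_right, inner_smul_right, h5, mul_zero, add_zero] at h1
    have hs := (mul_eq_zero.mp h1).resolve_right (inner_self_ne_zero.mpr hi)
    rw [hs, zero_smul, zero_add] at hst
    refine ⟨hs, (smul_eq_zero.mp hst).resolve_right fun h => hi ?_⟩
    have := act_quatI_quatI (q i)
    rw [h, map_zero] at this
    exact neg_eq_zero.mp this.symm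
  have h2 := finrank_span_eq_card hli
  rw [Fintype.card_fin] at h2
  refine h2.symm.le.trans (Submodule.finrank_mono (Submodule.span_le.mpr ?_))
  rintro _ ⟨k, rfl⟩
  fin_cases k
  · exact mem_motionSpan m q i
  · exact quatI_mem_motionSpan m q hk (mem_motionSpan m q i)

lemma blockDiag_translations (A : E4 →ₗ[ℝ] E4) {x : Config n} (hx : x ∈ translations n) :
    blockDiag n A x ∈ translations n := by
  obtain ⟨v, rfl⟩ := translations_eq hx
  exact mem_translations (A v)

/-- Block diagonal maps always preserve translations, so only `q` and the rotations of `q` need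
checking. -/
lemma splitOff_blockDiag (hp : IsPlanarRE m q) {A : E4 →ₗ[ℝ] E4}
    (hA : blockDiag n A q ∈ rotationDirections m q)
    (hA' : ∀ a, IsSkew a → blockDiag n A (blockDiag n a q) ∈ rotationDirections m q)
    {w : Config n} (hw : w ∈ splitOff m q) : blockDiag n A w ∈ splitOff m q := by
  obtain ⟨t, ht, v, hv, rfl⟩ := Submodule.mem_sup.mp hw
  rw [rotationDirections_of_planar hp] at hv
  obtain ⟨c, hc, z, hz, rfl⟩ := Submodule.mem_sup.mp hv
  obtain ⟨c, rfl⟩ := Submodule.mem_span_singleton.mp hc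
  obtain ⟨a, ha, rfl⟩ := orbitTangent_eq hz
  rw [map_add, map_add, map_smul]
  exact Submodule.add_mem_sup (blockDiag_translations A ht)
    (add_mem (Submodule.smul_mem _ _ hA) (hA' a ha))

lemma splitOff_rankOne (hp : IsPlanarRE m q) {f g : E4} (hf : f ∈ (motionSpan m q)ᗮ)
    (hg : g ∈ (motionSpan m q)ᗮ) {w : Config n} (hw : w ∈ splitOff m q) :
    blockDiag n (rankOne f g) w ∈ splitOff m q := by
  have h0 : ∀ u ∈ (motionSpan m q)ᗮ, ∀ i, ⟪u, q i⟫_ℝ = 0 := fun u hu i => by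
    rw [real_inner_comm]; exact hu _ (mem_motionSpan m q i)
  refine splitOff_blockDiag hp ?_ (fun a ha => ?_) hw
  · have : blockDiag n (rankOne f g) q = 0 := by
      ext1 i
      rw [blockDiag_apply, rankOne_apply, h0 f hf, zero_smul]
      rfl
    rw [this]
    exact zero_mem _
  · have : blockDiag n (rankOne f g) (blockDiag n a q) = blockDiag n (wedge (-a f) g) q := by
      ext1 i
      simp only [blockDiag_apply, wedge, rankOne_apply, LinearMap.sub_apply, h0 g hg, zero_smul,
        sub_zero, inner_neg_left, ha f, neg_neg]
    rw [this, rotationDirections_of_planar hp]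
    exact Submodule.mem_sup_right (mem_orbitTangent_of_skew q (wedge_skew _ _))

/-- The orthogonal projection onto the plane of motion, as a linear map. -/
def planeProj (m : Fin n → ℝ) (q : Config n) : E4 →ₗ[ℝ] E4 :=
  ((motionSpan m q).starProjection : E4 →ₗ[ℝ] E4)

lemma planeProj_mem (m : Fin n → ℝ) (q : Config n) (x : E4) : planeProj m q x ∈ motionSpan m q :=
  (motionSpan m q).starProjection_apply_mem x

lemma planeProj_of_mem {x : E4} (hx : x ∈ motionSpan m q) : planeProj m q x = x :=
  Submodule.starProjection_eq_self_iff.mpr hx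

lemma planeProj_of_mem_orthogonal {x : E4} (hx : x ∈ (motionSpan m q)ᗮ) : planeProj m q x = 0 :=
  (Submodule.starProjection_apply_eq_zero_iff _).mpr hx

lemma splitOff_planeProj (hp : IsPlanarRE m q) (hk : angularSpeed m q ≠ 0) {w : Config n}
    (hw : w ∈ splitOff m q) : blockDiag n (planeProj m q) w ∈ splitOff m q := by
  refine splitOff_blockDiag hp ?_ (fun a ha => ?_) hw
  · have : blockDiag n (planeProj m q) q = q := by
      ext1 i
      exact planeProj_of_mem (mem_motionSpan m q i)
    rw [this, rotationDirections_of_planar hp]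
    exact Submodule.mem_sup_left (Submodule.mem_span_singleton_self q)
  · obtain ⟨c, hc⟩ := starProjection_skew ha
      (fun x hx => quatI_mem_motionSpan m q hk hx) hp
    have : blockDiag n (planeProj m q) (blockDiag n a q) = c • blockDiag n (act quatI) q := by
      ext1 i
      exact hc _ (mem_motionSpan m q i)
    rw [this, rotationDirections_of_planar hp]
    exact Submodule.smul_mem _ _ (Submodule.mem_sup_right (mem_orbitTangent_of_skew q quatI_skew))

/-- Block diagonal maps commute with `M`, so the adjoint of one preserving `splitOff` preserves its
mass-orthogonal complement. -/
lemma reduced_blockDiag {A A' : E4 →ₗ[ℝ] E4} (hAA : ∀ x y, ⟪A x, y⟫_ℝ = ⟪x, A' y⟫_ℝ)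
    (hA : ∀ w ∈ splitOff m q, blockDiag n A w ∈ splitOff m q) {x : Config n}
    (hx : x ∈ reduced m q) : blockDiag n A' x ∈ reduced m q := by
  rw [mem_reduced] at hx ⊢
  intro w hw
  rw [← hx _ (hA w hw), massMatrix_blockDiag]
  simp only [inner_config, blockDiag_apply, hAA]

/-- The part of the reduced space whose bodies are fixed by `A`. -/
def reducedPart (m : Fin n → ℝ) (q : Config n) (A : E4 →ₗ[ℝ] E4) : Submodule ℝ (Config n) :=
  reduced m q ⊓ LinearMap.eqLocus (blockDiag n A) LinearMap.id

lemma mem_reducedPart {A : E4 →ₗ[ℝ] E4} {x : Config n} :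
    x ∈ reducedPart m q A ↔ x ∈ reduced m q ∧ ∀ i, A (x i) = x i := by
  rw [reducedPart, Submodule.mem_inf, LinearMap.mem_eqLocus]
  refine and_congr_right fun _ => ⟨fun h i => ?_, fun h => by ext1 i; exact h i⟩
  exact congrArg (fun y : Config n => y i) h

/-- The differences `qᵢ - qⱼ` lie in the plane of motion, so the rank one term of the second
derivative drops out. -/
lemma inner_hessU_of_normal (hq : IsCentralConfiguration m q) (x : Config n) {y : Config n}
    (hy : ∀ i, y i ∈ (motionSpan m q)ᗮ) : ⟪hessU m q x, y⟫_ℝ =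
      -∑ i, ∑ j ∈ Finset.Ioi i, m i * m j * (⟪x i - x j, y i - y j⟫_ℝ / ‖q i - q j‖ ^ 3) := by
  rw [inner_hessU m hq.collisionFree]
  simp only [← Finset.sum_neg_distrib]
  refine Finset.sum_congr rfl fun i _ => Finset.sum_congr rfl fun j _ => ?_
  have h : ⟪q i - q j, y i - y j⟫_ℝ = 0 :=
    (sub_mem (hy i) (hy j) : y i - y j ∈ (motionSpan m q)ᗮ) _
      (sub_mem (mem_motionSpan m q i) (mem_motionSpan m q j))
  rw [h]
  ring

lemma inner_hessU_eq_zero_of_normal (hq : IsCentralConfiguration m q) {x y : Config n}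
    (hy : ∀ i, y i ∈ (motionSpan m q)ᗮ) (hxy : ∀ i j, ⟪x i, y j⟫_ℝ = 0) :
    ⟪hessU m q x, y⟫_ℝ = 0 := by
  rw [inner_hessU_of_normal hq x hy]
  simp [inner_sub_left, inner_sub_right, hxy]

lemma inner_massMatrix_eq_zero {x y : Config n} (hxy : ∀ i j, ⟪x i, y j⟫_ℝ = 0) :
    ⟪massMatrix m x, y⟫_ℝ = 0 := by
  simp [inner_config, scaleBodies, inner_smul_left, hxy]

lemma frameK_of_planar (hp : IsPlanarRE m q) (x : Config n) (i : Fin n) :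
    frameK m q x i = angularSpeed m q • act quatI (planeProj m q (x i)) := by
  have hG : frameGenerator m q = angularSpeed m q •
      (act quatI ∘ₗ ((motionSpan m q).starProjection : E4 →ₗ[ℝ] E4)) := by
    unfold frameGenerator; rw [if_pos hp]
  rw [frameK, hG]
  rfl

lemma frameK_of_normal (hp : IsPlanarRE m q) {x : Config n}
    (hx : ∀ i, x i ∈ (motionSpan m q)ᗮ) : frameK m q x = 0 := by
  ext1 i
  rw [frameK_of_planar hp, planeProj_of_mem_orthogonal (hx i), map_zero, smul_zero]
  rfl

lemma frameK_of_mem_plane (hp : IsPlanarRE m q) {x : Config n}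
    (hx : ∀ i, x i ∈ motionSpan m q) :
    frameK m q x = angularSpeed m q • blockDiag n (act quatI) x := by
  ext1 i
  rw [frameK_of_planar hp, planeProj_of_mem (hx i)]
  rfl

/-- `K` vanishes on normal vectors, and `-D²U` is a positive combination of the `|xᵢ - xⱼ|²`. It
vanishes only on translations, which meet the reduced space in `0`. -/
lemma effForm_pos_of_normal (hm : ∀ i, 0 < m i) (hq : IsCentralConfiguration m q)
    (hp : IsPlanarRE m q) {x : Config n} (hx : ∀ i, x i ∈ (motionSpan m q)ᗮ)
    (hxr : x ∈ reduced m q) (hx0 : x ≠ 0) : 0 < effForm m q x := by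
  rw [effForm_apply, frameK_of_normal hp hx, inner_hessU_of_normal hq x hx, neg_neg,
    inner_zero_right, sub_zero]
  have h0 : ∀ i j, 0 ≤ m i * m j * (⟪x i - x j, x i - x j⟫_ℝ / ‖q i - q j‖ ^ 3) := fun i j =>
    mul_nonneg (mul_pos (hm i) (hm j)).le (div_nonneg real_inner_self_nonneg (by positivity))
  by_contra hle
  have hle' := le_antisymm (not_lt.mp hle)
    (Finset.sum_nonneg fun i _ => Finset.sum_nonneg fun j _ => h0 i j)
  have h1 : ∀ i j, i < j → x i = x j := by
    intro i j hij
    have h2 := (Finset.sum_eq_zero_iff_of_nonneg fun i _ =>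
      Finset.sum_nonneg fun j _ => h0 i j).mp hle' i (Finset.mem_univ _)
    have h3 := (Finset.sum_eq_zero_iff_of_nonneg fun j _ => h0 i j).mp h2 j
      (Finset.mem_Ioi.mpr hij)
    have h4 : (0 : ℝ) < ‖q i - q j‖ ^ 3 :=
      pow_pos (norm_pos_iff.mpr (sub_ne_zero_of_mem_Ioi hq.collisionFree
        (Finset.mem_Ioi.mpr hij))) 3
    rcases mul_eq_zero.mp h3 with h5 | h5
    · exact absurd h5 (mul_pos (hm i) (hm j)).ne'
    · have h6 := (div_eq_zero_iff.mp h5).resolve_right h4.ne'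
      exact sub_eq_zero.mp (inner_self_eq_zero.mp h6)
  have h2 : ∀ i j, x i = x j := fun i j => by
    rcases lt_trichotomy i j with h | h | h
    · exact h1 i j h
    · rw [h]
    · exact (h1 j i h).symm
  have h3 : x ∈ splitOff m q := by
    obtain ⟨i, -⟩ : ∃ i, x i ≠ 0 := by
      by_contra! h
      exact hx0 (by ext1 i; exact h i)
    have : x = WithLp.toLp 2 fun _ => x i := by
      ext1 j; exact h2 j i
    rw [this]
    exact Submodule.mem_sup_left (mem_translations _)
  exact hx0 (Submodule.disjoint_def.mp (disjoint_splitOff_reduced hm q) x h3 hxr)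

/-- On normal vectors the Hessian depends only on inner products of the `xᵢ`. Turning the line of
`f` isometrically into that of `g` does not change it. -/
lemma hessForm_rankOne (hq : IsCentralConfiguration m q) {f g : E4}
    (hf : f ∈ (motionSpan m q)ᗮ) (hg : g ∈ (motionSpan m q)ᗮ) (hff : ⟪f, f⟫_ℝ = 1)
    (hgg : ⟪g, g⟫_ℝ = 1) {x : Config n} (hx : x ∈ reducedPart m q (rankOne f f)) :
    hessForm m q (blockDiag n (rankOne f g) x) = hessForm m q x := by
  have hx2 := (mem_reducedPart.mp hx).2
  have hxf : ∀ i, x i ∈ (motionSpan m q)ᗮ := fun i => by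
    rw [← hx2 i]; exact Submodule.smul_mem _ _ hf
  have hxg : ∀ i, blockDiag n (rankOne f g) x i ∈ (motionSpan m q)ᗮ := fun i =>
    Submodule.smul_mem _ _ hg
  have key : ∀ v w : E4, rankOne f f v = v → rankOne f f w = w →
      ⟪rankOne f g v, rankOne f g w⟫_ℝ = ⟪v, w⟫_ℝ := by
    intro v w hv hw
    conv_rhs => rw [← hv, ← hw]
    simp only [rankOne_apply, inner_smul_left, inner_smul_right, hff, hgg]
  have hsub : ∀ i j, rankOne f f (x i - x j) = x i - x j := fun i j => by
    rw [map_sub, hx2, hx2]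
  rw [hessForm_apply, hessForm_apply, inner_hessU_of_normal hq _ hxf,
    inner_hessU_of_normal hq _ hxg, inner_massMatrix_self, inner_massMatrix_self]
  simp only [blockDiag_apply, ← map_sub, key _ _ (hsub _ _) (hsub _ _),
    ← real_inner_self_eq_norm_sq (_ : E4), key _ _ (hx2 _) (hx2 _)]

lemma map_reducedPart (hp : IsPlanarRE m q) {f g : E4}
    (hf : f ∈ (motionSpan m q)ᗮ) (hg : g ∈ (motionSpan m q)ᗮ) (hff : ⟪f, f⟫_ℝ = 1)
    (hgg : ⟪g, g⟫_ℝ = 1) :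
    (reducedPart m q (rankOne f f)).map (blockDiag n (rankOne f g)) =
      reducedPart m q (rankOne g g) := by
  have hN : ∀ {u v : E4}, u ∈ (motionSpan m q)ᗮ → v ∈ (motionSpan m q)ᗮ → ∀ {x},
      x ∈ reduced m q → blockDiag n (rankOne u v) x ∈ reduced m q := fun hu hv _ hx =>
    reduced_blockDiag (fun x y => inner_rankOne _ _ x y)
      (fun w hw => splitOff_rankOne hp hv hu hw) hx
  refine le_antisymm ?_ fun y hy => ?_
  · rintro _ ⟨x, hx, rfl⟩
    refine mem_reducedPart.mpr ⟨hN hf hg (mem_reducedPart.mp hx).1, fun i => ?_⟩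
    exact rankOne_rankOne hgg f g (x i)
  · obtain ⟨hy1, hy2⟩ := mem_reducedPart.mp hy
    refine ⟨blockDiag n (rankOne g f) y, mem_reducedPart.mpr ⟨hN hg hf hy1, fun i => ?_⟩, ?_⟩
    · exact rankOne_rankOne hff g f (y i)
    · ext1 i
      exact (rankOne_rankOne hff g g (y i)).trans (hy2 i)

/-- In the planar case the normal part of the reduced space contributes an even amount to index
and nullity of the Hessian, and nothing to those of the effective potential. -/
lemma index_parity_of_planar (hn : 3 ≤ n) (hm : ∀ i, 0 < m i) (hq : IsCentralConfiguration m q)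
    (hp : IsPlanarRE m q) :
    (∃ k, sigPos ((hessForm m q).restrict (reduced m q)) =
      sigNeg ((effForm m q).restrict (reduced m q)) + 2 * k) ∧
    ∃ k, Module.finrank ℝ ((hessForm m q).restrict (reduced m q)).radical =
      Module.finrank ℝ ((effForm m q).restrict (reduced m q)).radical + 2 * k := by
  have hk := angularSpeed_ne_zero hn hm hq
  obtain ⟨f, g, hf, hg, hff, hgg, hfg, hsum⟩ :=
    exists_normal_frame (finrank_motionSpan hp hk hq.ne_zero)
  set P := reducedPart m q (planeProj m q)
  set F := reducedPart m q (rankOne f f)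
  set G := reducedPart m q (rankOne g g) with hG
  have mP : ∀ x ∈ P, ∀ i, x i ∈ motionSpan m q := fun x hx i => by
    rw [← (mem_reducedPart.mp hx).2 i]; exact planeProj_mem m q _
  have mF : ∀ x ∈ F, ∀ i, x i ∈ (motionSpan m q)ᗮ := fun x hx i => by
    rw [← (mem_reducedPart.mp hx).2 i]; exact Submodule.smul_mem _ _ hf
  have mG : ∀ x ∈ G, ∀ i, x i ∈ (motionSpan m q)ᗮ := fun x hx i => by
    rw [← (mem_reducedPart.mp hx).2 i]; exact Submodule.smul_mem _ _ hg
  have mFG : ∀ x ∈ F ⊔ G, ∀ i, x i ∈ (motionSpan m q)ᗮ := fun x hx i => by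
    obtain ⟨y, hy, z, hz, rfl⟩ := Submodule.mem_sup.mp hx
    exact add_mem (mF y hy i) (mG z hz i)
  have oFG : ∀ x ∈ F, ∀ y ∈ G, ∀ i j, ⟪x i, y j⟫_ℝ = 0 := fun x hx y hy i j => by
    rw [← (mem_reducedPart.mp hx).2 i, ← (mem_reducedPart.mp hy).2 j]
    simp only [rankOne_apply, inner_smul_left, inner_smul_right, hfg, mul_zero]
  have oP : ∀ x ∈ P, ∀ y ∈ F ⊔ G, ∀ i j, ⟪x i, y j⟫_ℝ = 0 := fun x hx y hy i j =>
    mFG y hy j _ (mP x hx i)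
  have hdisj : ∀ {S T : Submodule ℝ (Config n)}, (∀ x ∈ S, ∀ y ∈ T, ∀ i j, ⟪x i, y j⟫_ℝ = 0) →
      Disjoint S T := by
    intro S T h
    rw [Submodule.disjoint_def]
    intro x hS hT
    ext1 i
    exact inner_self_eq_zero.mp (h x hS x hT i i)
  have dFG := hdisj oFG
  have dP := hdisj oP
  -- The three orthogonal projections of `ℝ⁴` act body by body and preserve the reduced space.
  have hsup : P ⊔ (F ⊔ G) = reduced m q := by
    refine le_antisymm (sup_le inf_le_left (sup_le inf_le_left inf_le_left)) fun x hx => ?_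
    have hx1 : x = blockDiag n (planeProj m q) x +
        (blockDiag n (rankOne f f) x + blockDiag n (rankOne g g) x) := by
      ext1 i
      exact hsum (x i)
    rw [hx1]
    refine Submodule.add_mem_sup ?_ (Submodule.add_mem_sup ?_ ?_)
    · refine mem_reducedPart.mpr ⟨reduced_blockDiag
        (fun x y => Submodule.inner_starProjection_left_eq_right _ x y)
        (fun w hw => splitOff_planeProj hp hk hw) hx, fun i => ?_⟩
      exact planeProj_of_mem (planeProj_mem m q _)
    · refine mem_reducedPart.mpr ⟨reduced_blockDiag (fun x y => inner_rankOne _ _ x y)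
        (fun w hw => splitOff_rankOne hp hf hf hw) hx, fun i => ?_⟩
      exact rankOne_rankOne hff f f (x i)
    · refine mem_reducedPart.mpr ⟨reduced_blockDiag (fun x y => inner_rankOne _ _ x y)
        (fun w hw => splitOff_rankOne hp hg hg hw) hx, fun i => ?_⟩
      exact rankOne_rankOne hgg g g (x i)
  have h1 := sig_sup (hessForm m q) dP fun x hx y hy =>
    hessForm_add hq (inner_hessU_eq_zero_of_normal hq (mFG y hy) (oP x hx y hy))
      (inner_massMatrix_eq_zero (oP x hx y hy))
  have h2 := sig_sup (hessForm m q) dFG fun x hx y hy =>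
    hessForm_add hq (inner_hessU_eq_zero_of_normal hq (mG y hy) (oFG x hx y hy))
      (inner_massMatrix_eq_zero (oFG x hx y hy))
  have h3 := sig_sup (effForm m q) dP fun x hx y hy =>
    effForm_add hq (inner_hessU_eq_zero_of_normal hq (mFG y hy) (oP x hx y hy))
      (by rw [frameK_of_normal hp (mFG y hy), inner_zero_right])
  have h4 := sig_of_pos (effForm m q) (S := F ⊔ G) fun x hx hx0 =>
    effForm_pos_of_normal hm hq hp (mFG x hx) (hsup ▸ Submodule.mem_sup_right hx) hx0
  have h5 : (effForm m q).restrict P = (-hessForm m q).restrict P :=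
    sig_congr _ _ fun x hx => effForm_eq_neg_hessForm hn hm hq (frameK_of_mem_plane hp (mP x hx))
  have h6 := restrict_equivalent (hessForm m q) (hessForm m q) (S := F)
    (blockDiag n (rankOne f g)) (fun x hx h0 => by
      ext1 i
      have h7 : rankOne f g (x i) = 0 := congrArg (fun y : Config n => y i) h0
      have h8 : ⟪f, x i⟫_ℝ = 0 := by
        have := congrArg (fun y => ⟪g, y⟫_ℝ) h7
        simpa only [rankOne_apply, inner_smul_right, hgg, mul_one, inner_zero_right] using this
      rw [← (mem_reducedPart.mp hx).2 i, rankOne_apply, h8, zero_smul]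
      rfl) (fun x hx => hessForm_rankOne hq hf hg hff hgg hx)
  rw [map_reducedPart hp hf hg hff hgg, ← hG] at h6
  have h7 := h6.sigPos_eq
  have h8 := h6.rank_radical_eq
  have h9 := sig_neg_restrict (hessForm m q) P
  rw [hsup] at h1 h3
  rw [h5] at h3
  -- The copies `F` and `G` contribute equally to the Hessian, hence twice the value on `F`; the
  -- effective form gets nothing from them.
  exact ⟨⟨sigPos ((hessForm m q).restrict F), by omega⟩,
    ⟨Module.finrank ℝ ((hessForm m q).restrict F).radical, by omega⟩⟩

end Planar

/-! ### Parity of index and nullity of `B₃`, and instability. -/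

section Stability

variable {m : Fin n → ℝ} {q : Config n}

/-- The signature of the Hessian on the reduced space, compared with the effective potential. -/
lemma index_parity (hn : 3 ≤ n) (hm : ∀ i, 0 < m i) (hq : IsCentralConfiguration m q) :
    (∃ k, sigPos ((hessForm m q).restrict (reduced m q)) =
      sigNeg ((effForm m q).restrict (reduced m q)) + 2 * k) ∧
    ∃ k, Module.finrank ℝ ((hessForm m q).restrict (reduced m q)).radical =
      Module.finrank ℝ ((effForm m q).restrict (reduced m q)).radical + 2 * k := by
  by_cases hp : IsPlanarRE m q
  · exact index_parity_of_planar hn hm hq hp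
  · have h : (effForm m q).restrict (reduced m q) = (-hessForm m q).restrict (reduced m q) :=
      sig_congr _ _ fun x _ => effForm_eq_neg_hessForm hn hm hq (frameK_of_not_planar hp x)
    have h2 := sig_neg_restrict (hessForm m q) (reduced m q)
    rw [h]
    exact ⟨⟨0, h2.1.symm⟩, ⟨0, h2.2.symm⟩⟩

/-- Parity of the nullity of `B₃`. -/
lemma even_nullity_formB₃ (hn : 3 ≤ n) (hm : ∀ i, 0 < m i) (hq : IsCentralConfiguration m q) :
    Even (Module.finrank ℝ (formB₃ m q).radical) ↔ ¬ Even (nullity m q) := by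
  obtain ⟨Z, hZ⟩ := exists_isRotationComplement hq
  have h1 := (hZ.index_nullity hm hq).2
  have h2 := (index_formB₃ hm q).2.1
  obtain ⟨-, k, h3⟩ := index_parity hn hm hq
  obtain ⟨b, hb⟩ := blockSize_even m q
  rw [h2]
  simp only [Nat.even_iff]
  omega

/-- Parity of the index of `B₃`. -/
lemma even_index_formB₃ (hn : 3 ≤ n) (hm : ∀ i, 0 < m i) (hq : IsCentralConfiguration m q) :
    Even (sigNeg (formB₃ m q)) ↔ ¬ Even (morseIndex m q + nullity m q) := by
  obtain ⟨Z, hZ⟩ := exists_isRotationComplement hq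
  have h1 := hZ.index_nullity hm hq
  have h2 := (index_formB₃ hm q).1
  obtain ⟨⟨k, h3⟩, -⟩ := index_parity hn hm hq
  obtain ⟨b, hb⟩ := blockSize_even m q
  have h4 := hZ.finrank_reduced hn hm hq
  have h5 := sig_add_radical_restrict (hessForm m q) (reduced m q)
  rw [h2]
  -- On the reduced space, of even dimension `4n - 4 - k`, the positive index is the dimension minus
  -- `n⁻` minus the reduced nullity, and the latter is `n⁰ + 1 - k`.
  simp only [Nat.even_iff]
  omega

/-- The exponent defining the generalized kernel is the full dimension, so the kernels of powers
have stabilized there; in particular the natural subtraction is never truncated. -/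
lemma finrank_E₃ (hn : 3 ≤ n) (hm : ∀ i, 0 < m i) (hq : IsCentralConfiguration m q) :
    8 * n - 8 - 2 * blockSize m q = Module.finrank ℝ (E₃ m q) := by
  obtain ⟨Z, hZ⟩ := exists_isRotationComplement hq
  have h4 := hZ.finrank_reduced hn hm hq
  have h2 := (index_formB₃ hm q).2.2
  omega

/-- The symplectic form on `E₃`. -/
def sympForm₃ (m : Fin n → ℝ) (q : Config n) : LinearMap.BilinForm ℝ (E₃ m q) :=
  (sympForm n).domRestrict₁₂ (E₃ m q) (E₃ m q)

lemma sympForm₃_skew (x y : E₃ m q) : sympForm₃ m q x y = -sympForm₃ m q y x := by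
  change sympForm n x y = -sympForm n y x
  rw [sympForm_apply, sympForm_apply, real_inner_comm (y : Phase n).1, real_inner_comm _
    (x : Phase n).1]
  ring

lemma sympForm₃_nondegenerate (hm : ∀ i, 0 < m i) (x : E₃ m q)
    (h : ∀ y, sympForm₃ m q x y = 0) : x = 0 := by
  obtain ⟨⟨x, p⟩, hx⟩ := x
  have hx' := (mem_E₃ hm).mp hx
  have h1 : sympForm n (x, p) (0, massMatrix m x) = 0 := h ⟨(0, massMatrix m x), (mem_E₃ hm).mpr
    ⟨zero_mem _, by rw [massMatrixInv_massMatrix hm]; exact hx'.1⟩⟩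
  have h2 : sympForm n (x, p) (massMatrixInv m p, 0) = 0 := h ⟨(massMatrixInv m p, 0),
    (mem_E₃ hm).mpr ⟨hx'.2, by rw [map_zero]; exact zero_mem _⟩⟩
  rw [sympForm_apply, inner_zero_right, neg_zero, zero_add, real_inner_comm] at h1
  rw [sympForm_apply, inner_zero_right, add_zero, neg_eq_zero] at h2
  have e1 := eq_zero_of_inner_massMatrix_self hm h1
  have e2 : massMatrixInv m p = 0 := eq_zero_of_inner_massMatrix_self hm (by
    rw [massMatrix_massMatrixInv hm]; exact h2)
  have e3 : p = 0 := by rw [← massMatrix_massMatrixInv hm p, e2, map_zero]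
  ext1
  exact Prod.ext e1 e3

lemma sympForm₃_matJB₃ (hm : ∀ i, 0 < m i) (hq : IsCentralConfiguration m q) (x y : E₃ m q) :
    sympForm₃ m q x (matJB₃ hm hq y) = -sympForm₃ m q (matJB₃ hm hq x) y :=
  sympForm_matJB hq x y

lemma formB₃_eq (hm : ∀ i, 0 < m i) (hq : IsCentralConfiguration m q) (x : E₃ m q) :
    formB₃ m q x = -sympForm₃ m q (matJB₃ hm hq x) x :=
  formB_eq_sympForm m q x

/-- An even `n⁰` makes `ker JB₃`, which is the radical of `B₃`, odd-dimensional. -/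
lemma hasNontrivialJordanBlockAtZero_of_even_nullity (hn : 3 ≤ n) (hm : ∀ i, 0 < m i)
    (hq : IsCentralConfiguration m q) (h : Even (nullity m q)) :
    HasNontrivialJordanBlockAtZero hm hq := by
  refine lt_of_le_not_ge (fun x hx => ?_) fun hle => ?_
  · rw [LinearMap.mem_ker] at hx ⊢
    rw [pow_two, Module.End.mul_apply, hx, map_zero]
  · have h1 := even_finrank_ker (sympForm₃ m q) (matJB₃ hm hq) sympForm₃_skew
      (sympForm₃_nondegenerate hm) (sympForm₃_matJB₃ hm hq) hle
    rw [← radical_eq_ker (sympForm₃ m q) (matJB₃ hm hq) sympForm₃_skew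
      (sympForm₃_nondegenerate hm) (sympForm₃_matJB₃ hm hq) (formB₃ m q) (formB₃_eq hm hq)] at h1
    exact (even_nullity_formB₃ hn hm hq).mp h1 h

lemma not_linearlyStable_of_jordanBlock (hm : ∀ i, 0 < m i) (hq : IsCentralConfiguration m q)
    (h : HasNontrivialJordanBlockAtZero hm hq) : ¬ LinearlyStable hm hq := fun hs =>
  h.not_ge (ker_sq_le_of_diagonalizable (matJB₃ hm hq) hs.2)

/-- Spectral stability would make the index of `B₃` even, like that on the generalized kernel,
whereas it has the parity of `n⁻ + n⁰ + 1`. -/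
lemma not_spectrallyStable (hn : 3 ≤ n) (hm : ∀ i, 0 < m i) (hq : IsCentralConfiguration m q)
    (hk : Even (indexOnGeneralizedKernel hm hq)) (h : Even (morseIndex m q + nullity m q)) :
    ¬ SpectrallyStable hm hq := by
  intro hs
  have h1 := even_sigNeg_iff (sympForm₃ m q) (matJB₃ hm hq) sympForm₃_skew
    (sympForm₃_nondegenerate hm) (sympForm₃_matJB₃ hm hq)
    (no_real_eigenvalue_of_complex (matJB₃ hm hq) hs) (formB₃ m q) (formB₃_eq hm hq)
    (finrank_E₃ hn hm hq)
  exact (even_index_formB₃ hn hm hq).mp (h1.mpr hk) h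

end Stability

end NBody

end
theorem mainTheorem2 (n : ℕ) (hn : 3 ≤ n) (m : Fin n → ℝ) (hm : ∀ i, 0 < m i)
    (q : NBody.Config n) (hq : NBody.IsCentralConfiguration m q) :
    ((¬ NBody.IsPlanar q ∧ NBody.IsMorseBottNondegenerate m q) ∨
        (¬ NBody.IsMorseBottNondegenerate m q ∧ Even (NBody.nullity m q)) →
      NBody.HasNontrivialJordanBlockAtZero hm hq ∧ ¬ NBody.LinearlyStable hm hq) ∧
    (Even (NBody.indexOnGeneralizedKernel hm hq) →
      (Even (NBody.morseIndex m q + NBody.nullity m q) → ¬ NBody.SpectrallyStable hm hq) ∧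
      (NBody.IsMorseBottNondegenerate m q →
        (¬ NBody.IsPlanar q → Even (NBody.morseIndex m q) → ¬ NBody.SpectrallyStable hm hq) ∧
        (NBody.IsPlanar q → Odd (NBody.morseIndex m q) → ¬ NBody.SpectrallyStable hm hq))) := by
  have horb := NBody.even_finrank_orbitTangent_iff hq
  refine ⟨fun h => ?_, fun hk => ⟨NBody.not_spectrallyStable hn hm hq hk, fun hnd => ?_⟩⟩
  · have hev : Even (NBody.nullity m q) := by
      rcases h with ⟨hp, hnd⟩ | ⟨-, h⟩
      · unfold NBody.IsMorseBottNondegenerate at hnd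
        rw [hnd]
        exact horb.mpr hp
      · exact h
    have hJ := NBody.hasNontrivialJordanBlockAtZero_of_even_nullity hn hm hq hev
    exact ⟨hJ, NBody.not_linearlyStable_of_jordanBlock hm hq hJ⟩
  · unfold NBody.IsMorseBottNondegenerate at hnd
    rw [← hnd] at horb
    refine ⟨fun hp h => ?_, fun hp h => ?_⟩
    · exact NBody.not_spectrallyStable hn hm hq hk (h.add (horb.mpr hp))
    -- The orbit of a planar configuration has dimension 3 or 5.
    · have hodd : Odd (NBody.nullity m q) :=
        Nat.not_even_iff_odd.mp fun h2 => horb.mp h2 hp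
      exact NBody.not_spectrallyStable hn hm hq hk (h.add_odd hodd)
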